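/- Let $0<\alpha<1$ and $t\ge 0$. Let $G$ be a finite simple undirected graph on a non-empty vertex set $V$, with real Laplacian matrix $L=D-A$ ($A$ the adjacency matrix, $D$ the diagonal matrix of vertex degrees). For a real number or a real square matrix $x$ let $$E_\alpha(x)=\sum_{k=0}^{\infty}\frac{x^{k}}{\Gamma(\alpha k+1)}$$ be the Mittag-Leffler function, and for $\theta\in\mathbb{R}$ let $$M_\alpha(\theta)=\sum_{k=0}^{\infty}\frac{(-\theta)^{k}}{k!\,\Gamma(1-\alpha(k+1))}$$ be the M-Wright (Mainardi) function, where $1/\Gamma$ is read as $0$ at the poles of $\Gamma$. These series converge absolutely, and the following hold. 1. The function $\lambda\mapsto E_\alpha(-t^{\alpha}\lambda)$ is completely monotone on $[0,\infty)$: it is continuous on $[0,\infty)$, infinitely differentiable on $(0,\infty)$, and $(-1)^n\frac{d^n}{d\lambda^n}E_\alpha(-t^\alpha\lambda)\ge 0$ for all $n\ge 0$ and $\lambda>0$. 2. $M_\alpha$ is a probability density on $(0,\infty)$: $M_\alpha(\theta)\ge 0$ for all $\theta\ge 0$, $M_\alpha$ is integrable on $(0,\infty)$, and $\int_0^\infty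 M_\alpha(\theta)\,d\theta=1$. 3. For every $\lambda\ge 0$, with an integrable integrand, $$E_\alpha(-t^{\alpha}\lambda)=\int_0^\infty e^{-\theta t^{\alpha}\lambda}\,M_\alpha(\theta)\,d\theta .$$ 4. The matrix $E_\alpha(-t^{\alpha}L)$ is a convex mixture of heat semigroups: as a (convergent) Bochner integral, $$E_\alpha(-t^{\alpha}L)=\int_0^\infty e^{-\theta t^{\alpha}L}\,M_\alpha(\theta)\,d\theta .$$ 5. $E_\alpha(-t^{\alpha}L)$ is self-adjoint and positive (that is, positive semidefinite), its operator norm induced by the Euclidean norm satisfies $\|E_\alpha(-t^{\alpha}L)\|_2=1$, and $E_\alpha(-t^{\alpha}L)\mathbf 1=\mathbf 1$, where $\mathbf 1$ is the vector with all entries $1$. -/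

import Mathlib

open scoped Matrix.Norms.L2Operator

/-- The Mittag-Leffler function `E_α(x) = ∑ₖ xᵏ / Γ(αk + 1)`, for `x` in a real topological algebra;
it is used for real numbers and for real square matrices. -/
noncomputable def mittagLeffler (α : ℝ) {A : Type*} [Ring A] [Algebra ℝ A] [TopologicalSpace A]
    (x : A) : A :=
  ∑' k : ℕ, (Real.Gamma (α * (k : ℝ) + 1))⁻¹ • x ^ k

/-- The M-Wright (Mainardi) function `M_α(θ) = ∑ₖ (-θ)ᵏ / (k! Γ(1 - α(k+1)))`.
A term in which `Γ` has a pole is zero, as usual: there `Real.Gamma` takes the value `0`, and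
division by `0` gives `0`. -/
noncomputable def mWright (α θ : ℝ) : ℝ :=
  ∑' k : ℕ, (-θ) ^ k / ((k.factorial : ℝ) * Real.Gamma (1 - α * ((k : ℝ) + 1)))

/-- `f` is completely monotone on `[0, ∞)`: it is continuous on `[0, ∞)`, smooth on `(0, ∞)`, and
`(-1)ⁿ f⁽ⁿ⁾ ≥ 0` on `(0, ∞)` for every `n`. -/
def CompletelyMonotone (f : ℝ → ℝ) : Prop :=
  ContinuousOn f (Set.Ici 0) ∧ ContDiffOn ℝ (⊤ : ℕ∞) f (Set.Ioi 0) ∧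
    ∀ n : ℕ, ∀ x : ℝ, 0 < x → 0 ≤ (-1) ^ n * iteratedDeriv n f x

open MeasureTheory Set Filter Topology

/-! ### Growth of the Gamma function and convergence of the defining series -/

/-! Everything rests on two facts about `M_α`: it is nonnegative on `[0, ∞)`, and its moments there
are `∫ θⁿ M_α(θ) dθ = n! / Γ(αn + 1)`. Integrating the exponential series of `e^{θa}` term by term
against `M_α` then produces `E_α(a)` in every real Banach algebra with `‖1‖ = 1`
(`mittagLeffler_eq_integral`); the scalar and the matrix identity are two instances. The moment `n =
0` is the total mass. Complete monotonicity follows because `λ ↦ E_α(-xλ)` is a moment generating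
function, and the matrix statements follow by diagonalising `L`, whose constant vectors lie in the
kernel.

Both facts come from the Laplace transform in `t` of the rescaled function `t^{-α} M_α(θ t^{-α})`,
which is `s^{α-1} e^{-θ s^α}` (`laplace_wrightDensity`). To compute it, the rescaled function is
written as a Hankel integral of `z^{α-1} e^{tz - θ z^α}`. The two rays of the contour are complex
conjugate, so one ray and an imaginary part suffice, and the substitution `z = e^w` turns this ray
into a horizontal line. Cauchy's theorem on horizontal strips does the rest.

Nonnegativity: `s^{α-1} e^{-θ s^α}` is a product of functions whose derivatives alternate in sign,
and a Post-Widder argument (`nonneg_of_forall_integral_pow_mul_exp_nonneg`) carries the sign back to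
the original function. Moments: integrate `e^{-t} θⁿ t^{-α} M_α(θ t^{-α})` over the quadrant in both
orders. One order gives `Γ(αn + 1)` times the moment, the other gives `∫ θⁿ e^{-θ} dθ = n!`. -/

lemma Gamma_add_le_mul_rpow {x a : ℝ} (hx : 0 < x) (ha0 : 0 < a) (ha1 : a < 1) :
    Real.Gamma (x + a) ≤ Real.Gamma x * x ^ a := by
  -- Log-convexity of `Γ`, with `x + a = (1 - a) x + a (x + 1)`.
  have h := Real.Gamma_mul_add_mul_le_rpow_Gamma_mul_rpow_Gamma hx (by linarith : 0 < x + 1)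
    (sub_pos.2 ha1) ha0 (by ring)
  have hG := Real.Gamma_pos_of_pos hx
  rw [Real.Gamma_add_one hx.ne', Real.mul_rpow hx.le hG.le, mul_left_comm,
    ← Real.rpow_add hG, sub_add_cancel, Real.rpow_one] at h
  calc Real.Gamma (x + a) = Real.Gamma ((1 - a) * x + a * (x + 1)) := by ring_nf
    _ ≤ _ := h
    _ = _ := mul_comm _ _

lemma summable_of_abs_succ_le {a : ℕ → ℝ} {C : ℝ} {e : ℕ → ℝ} (he : Tendsto e atTop (𝓝 0))
    (h : ∀ k, |a (k + 1)| ≤ C * e k * |a k|) : Summable a := by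
  refine summable_of_ratio_norm_eventually_le (r := 1 / 2) (by norm_num) ?_
  have h0 : Tendsto (fun k => C * e k) atTop (𝓝 0) := by simpa using he.const_mul C
  filter_upwards [h0.eventually_le_const (by norm_num : (0 : ℝ) < 1 / 2)] with k hk
  exact (h k).trans (mul_le_mul_of_nonneg_right hk (abs_nonneg _))

lemma summable_pow_mul_Gamma_div_factorial {α : ℝ} (hα0 : 0 < α) (hα1 : α < 1) (x : ℝ) :
    Summable fun k : ℕ => x ^ k * Real.Gamma (α * (k + 1)) / k.factorial := by
  have he : Tendsto (fun k : ℕ => ((k : ℝ) + 1) ^ (-(1 - α))) atTop (𝓝 0) :=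
    (tendsto_rpow_neg_atTop (sub_pos.2 hα1)).comp
      (tendsto_atTop_add_const_right _ _ tendsto_natCast_atTop_atTop)
  refine summable_of_abs_succ_le (C := |x|) he fun k => ?_
  have hk : (0 : ℝ) < k + 1 := by positivity
  have hp : 0 < α * ((k : ℝ) + 1) := by positivity
  have hG := Real.Gamma_pos_of_pos hp
  have h1 : Real.Gamma (α * ((k + 1 : ℕ) + 1)) ≤
      Real.Gamma (α * (k + 1)) * ((k : ℝ) + 1) ^ α := by
    have := Gamma_add_le_mul_rpow hp hα0 hα1
    have h2 : (α * ((k : ℝ) + 1)) ^ α ≤ ((k : ℝ) + 1) ^ α :=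
      Real.rpow_le_rpow hp.le (by nlinarith) hα0.le
    calc Real.Gamma (α * ((k + 1 : ℕ) + 1)) = Real.Gamma (α * (k + 1) + α) := by
          push_cast; ring_nf
      _ ≤ _ := this
      _ ≤ _ := by gcongr
  have hG' : 0 < Real.Gamma (α * ((k + 1 : ℕ) + 1)) := Real.Gamma_pos_of_pos (by positivity)
  have h3 : ((k : ℝ) + 1) ^ (-(1 - α)) = ((k : ℝ) + 1) ^ α / (k + 1) := by
    rw [neg_sub, Real.rpow_sub hk, Real.rpow_one]
  rw [abs_div, abs_div, abs_mul, abs_mul, abs_of_pos hG, abs_of_pos hG', h3, Nat.factorial_succ,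
    Nat.abs_cast, Nat.abs_cast, abs_pow, abs_pow, pow_succ]
  push_cast at h1 ⊢
  rw [div_le_iff₀ (by positivity)]
  calc |x| ^ k * |x| * Real.Gamma (α * (k + 1 + 1))
      ≤ |x| ^ k * |x| * (Real.Gamma (α * (k + 1)) * ((k : ℝ) + 1) ^ α) := by gcongr
    _ = _ := by field_simp

lemma summable_inv_Gamma_mul_pow {α : ℝ} (hα0 : 0 < α) (hα1 : α < 1) (x : ℝ) :
    Summable fun k : ℕ => (Real.Gamma (α * k + 1))⁻¹ * x ^ k := by
  have he : Tendsto (fun k : ℕ => (α * k + 1 : ℝ) ^ (-α)) atTop (𝓝 0) :=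
    (tendsto_rpow_neg_atTop hα0).comp
      (tendsto_atTop_add_const_right _ _
        (tendsto_natCast_atTop_atTop.const_mul_atTop hα0))
  refine summable_of_abs_succ_le (C := 2 * |x|) he fun k => ?_
  set y : ℝ := α * k + 1 with hy
  have hy1 : 1 ≤ y := by simp only [hy]; nlinarith [mul_nonneg hα0.le (Nat.cast_nonneg (α := ℝ) k)]
  have hy0 : 0 < y := by linarith
  have e1 : α * ((k + 1 : ℕ) : ℝ) + 1 = y + α := by simp only [hy]; push_cast; ring
  rw [e1]
  have hG := Real.Gamma_pos_of_pos hy0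
  have hG' : 0 < Real.Gamma (y + α) := Real.Gamma_pos_of_pos (by linarith)
  -- The upper bound for `Γ`, read as a lower bound at `y + α` by stepping `1 - α` up to `y + 1`.
  -- The factor 2 comes from `y + α ≤ 2y`.
  have h1 : y * Real.Gamma y ≤ Real.Gamma (y + α) * (2 * (y * y ^ (-α))) := by
    rw [← Real.Gamma_add_one hy0.ne']
    have := Gamma_add_le_mul_rpow (by linarith : 0 < y + α) (sub_pos.2 hα1)
      (by linarith : 1 - α < 1)
    calc Real.Gamma (y + 1) = Real.Gamma (y + α + (1 - α)) := by ring_nf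
      _ ≤ _ := this
      _ ≤ Real.Gamma (y + α) * (2 * y) ^ (1 - α) := by
          gcongr
          linarith
      _ ≤ Real.Gamma (y + α) * (2 * (y * y ^ (-α))) := by
          rw [Real.mul_rpow (by norm_num) hy0.le]
          have h2 : (2 : ℝ) ^ (1 - α) ≤ 2 := by
            simpa using Real.rpow_le_rpow_of_exponent_le (by norm_num : (1 : ℝ) ≤ 2)
              (by linarith : 1 - α ≤ 1)
          have h3 : y ^ (1 - α) = y * y ^ (-α) := by
            rw [sub_eq_add_neg, Real.rpow_add hy0, Real.rpow_one]
          rw [h3]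
          gcongr
  rw [abs_mul, abs_mul, abs_inv, abs_inv, abs_of_pos hG, abs_of_pos hG', abs_pow, abs_pow, pow_succ]
  have h4 : (Real.Gamma (y + α))⁻¹ ≤ 2 * y ^ (-α) * (Real.Gamma y)⁻¹ := by
    rw [inv_le_iff_one_le_mul₀ hG', mul_assoc, mul_assoc]
    have : Real.Gamma y ≤ Real.Gamma (y + α) * (2 * y ^ (-α)) := by
      refine le_of_mul_le_mul_left ?_ hy0
      linarith
    calc (1 : ℝ) = Real.Gamma y * (Real.Gamma y)⁻¹ := (mul_inv_cancel₀ hG.ne').symm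
      _ ≤ Real.Gamma (y + α) * (2 * y ^ (-α)) * (Real.Gamma y)⁻¹ := by gcongr
      _ = _ := by ring
  calc (Real.Gamma (y + α))⁻¹ * (|x| ^ k * |x|)
      ≤ 2 * y ^ (-α) * (Real.Gamma y)⁻¹ * (|x| ^ k * |x|) := by gcongr
    _ = _ := by ring

/-- Euler's reflection formula. It survives at the poles of `Γ(1 - p)`: there the sine vanishes and
the default values make both sides zero. -/
lemma inv_Gamma_one_sub_of_pos {p : ℝ} (hp : 0 < p) :
    (Real.Gamma (1 - p))⁻¹ = Real.Gamma p * Real.sin (Real.pi * p) / Real.pi := by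
  have hG := (Real.Gamma_pos_of_pos hp).ne'
  have h : Real.Gamma (1 - p) = Real.pi / Real.sin (Real.pi * p) / Real.Gamma p := by
    rw [← Real.Gamma_mul_Gamma_one_sub p]
    field_simp
  rw [h, inv_div, div_div_eq_mul_div]

lemma summable_mWright {α : ℝ} (hα0 : 0 < α) (hα1 : α < 1) (θ : ℝ) :
    Summable fun k : ℕ =>
      (-θ) ^ k / ((k.factorial : ℝ) * Real.Gamma (1 - α * ((k : ℝ) + 1))) := by
  refine ((summable_pow_mul_Gamma_div_factorial hα0 hα1 |θ|).div_const Real.pi).of_norm_bounded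
    fun k => ?_
  have hp : 0 < α * ((k : ℝ) + 1) := by positivity
  have hG := Real.Gamma_pos_of_pos hp
  rw [div_mul_eq_div_div, div_eq_mul_inv _ (Real.Gamma _), inv_Gamma_one_sub_of_pos hp,
    Real.norm_eq_abs, abs_mul, abs_div, abs_div, abs_mul, abs_pow, abs_neg, Nat.abs_cast,
    abs_of_pos hG, abs_of_pos Real.pi_pos]
  calc |θ| ^ k / k.factorial * (Real.Gamma (α * (k + 1)) * |Real.sin (Real.pi * (α * (k + 1)))| /
        Real.pi)
      ≤ |θ| ^ k / k.factorial * (Real.Gamma (α * (k + 1)) * 1 / Real.pi) := by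
        gcongr
        exact Real.abs_sin_le_one _
    _ = _ := by ring

lemma summable_mittagLeffler {α : ℝ} (hα0 : 0 < α) (hα1 : α < 1) {A : Type*} [NormedRing A]
    [NormOneClass A] [NormedAlgebra ℝ A] [CompleteSpace A] (a : A) :
    Summable fun k : ℕ => (Real.Gamma (α * (k : ℝ) + 1))⁻¹ • a ^ k := by
  refine (summable_inv_Gamma_mul_pow hα0 hα1 ‖a‖).of_norm_bounded fun k => ?_
  have hG : 0 < Real.Gamma (α * k + 1) := Real.Gamma_pos_of_pos (by positivity)
  rw [norm_smul, Real.norm_of_nonneg (inv_nonneg.2 hG.le)]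
  gcongr
  exact norm_pow_le a k

/-! ### Shifting horizontal lines of integration -/

lemma integrable_exp_neg_mul_abs {δ : ℝ} (hδ : 0 < δ) :
    Integrable fun u : ℝ => Real.exp (-(δ * |u|)) := by
  rw [← integrableOn_univ, ← Iic_union_Ioi (a := (0 : ℝ))]
  refine IntegrableOn.union ?_ ?_
  · refine (integrableOn_exp_mul_Iic hδ 0).congr_fun (fun u hu => ?_) measurableSet_Iic
    have hu' : u ≤ 0 := hu
    simp [abs_of_nonpos hu']
  · refine (exp_neg_integrableOn_Ioi 0 hδ).congr_fun (fun u hu => ?_) measurableSet_Ioi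
    have hu' : 0 < u := hu
    simp [abs_of_pos hu']

lemma integrable_of_exp_decay {f : ℝ → ℂ} (hf : Continuous f) {C δ : ℝ} (hδ : 0 < δ)
    (hb : ∀ u : ℝ, 1 ≤ |u| → ‖f u‖ ≤ C * Real.exp (-(δ * |u|))) : Integrable f := by
  obtain ⟨B, hB⟩ := isCompact_Icc.exists_bound_of_continuousOn (s := Icc (-1 : ℝ) 1)
    hf.continuousOn
  have hB0 : 0 ≤ B := (norm_nonneg _).trans (hB 0 (by norm_num))
  have hC0 : 0 ≤ C := by
    have := (norm_nonneg _).trans (hb 1 (by norm_num))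
    exact nonneg_of_mul_nonneg_left this (Real.exp_pos _)
  -- `B` bounds `f` on `[-1, 1]`, where `exp δ * exp (-δ|u|) ≥ 1`; so one multiple of the
  -- exponential dominates everywhere.
  refine ((integrable_exp_neg_mul_abs hδ).const_mul (C + B * Real.exp δ)).mono'
    hf.aestronglyMeasurable (Eventually.of_forall fun u => ?_)
  rcases le_or_gt 1 |u| with h | h
  · refine (hb u h).trans ?_
    gcongr
    have := Real.exp_pos δ
    nlinarith
  · have h1 := hB u (abs_le.1 h.le)
    have h2 : 1 ≤ Real.exp δ * Real.exp (-(δ * |u|)) := by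
      rw [← Real.exp_add]
      exact Real.one_le_exp (by nlinarith)
    have := Real.exp_pos (-(δ * |u|))
    nlinarith [mul_le_mul_of_nonneg_left h2 hB0, mul_nonneg hC0 this.le]

/-- Cauchy's theorem on the rectangles `[-R, R] × [a, b]`; the vertical sides vanish as `R → ∞`
because of the exponential decay. -/
lemma integral_horizontal_line_eq {K : ℂ → ℂ} {a b : ℝ} (hab : a ≤ b)
    (hd : ∀ w : ℂ, a ≤ w.im → w.im ≤ b → DifferentiableAt ℂ K w) {C δ : ℝ} (hδ : 0 < δ)
    (hb : ∀ w : ℂ, a ≤ w.im → w.im ≤ b → 1 ≤ |w.re| → ‖K w‖ ≤ C * Real.exp (-(δ * |w.re|))) :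
    ∫ u : ℝ, K (u + a * Complex.I) = ∫ u : ℝ, K (u + b * Complex.I) := by
  have him : ∀ u y : ℝ, ((u : ℂ) + y * Complex.I).im = y := by intro u y; simp
  have hre : ∀ u y : ℝ, ((u : ℂ) + y * Complex.I).re = u := by intro u y; simp
  have hint : ∀ y : ℝ, a ≤ y → y ≤ b → Integrable fun u : ℝ => K (u + y * Complex.I) := by
    intro y h1 h2
    refine integrable_of_exp_decay (C := C) ?_ hδ fun u hu => ?_
    · refine continuous_iff_continuousAt.2 fun u => ?_
      exact ContinuousAt.comp (g := K) (f := fun u : ℝ => (u : ℂ) + y * Complex.I)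
        (hd _ (by rwa [him]) (by rwa [him])).continuousAt (by fun_prop)
    · simpa only [hre] using hb (u + y * Complex.I) (by rwa [him]) (by rwa [him]) (by rwa [hre])
  have hlim : ∀ y : ℝ, a ≤ y → y ≤ b →
      Tendsto (fun R : ℝ => ∫ u in (-R)..R, K (u + y * Complex.I)) atTop
        (𝓝 (∫ u : ℝ, K (u + y * Complex.I))) := fun y h1 h2 =>
    intervalIntegral_tendsto_integral (hint y h1 h2) tendsto_neg_atTop_atBot tendsto_id
  have hside : ∀ s : ℝ, |s| = 1 →
      Tendsto (fun R : ℝ => ∫ y in a..b, K (((s * R : ℝ) : ℂ) + y * Complex.I)) atTop (𝓝 0) := by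
    intro s hs
    have h0 : Tendsto (fun R : ℝ => C * Real.exp (-(δ * R)) * |b - a|) atTop (𝓝 0) := by
      have : Tendsto (fun R : ℝ => Real.exp (-(δ * R))) atTop (𝓝 0) :=
        Real.tendsto_exp_neg_atTop_nhds_zero.comp (tendsto_id.const_mul_atTop hδ)
      simpa using (this.const_mul C).mul_const |b - a|
    refine squeeze_zero_norm' ?_ h0
    filter_upwards [eventually_ge_atTop 1] with R hR
    refine intervalIntegral.norm_integral_le_of_norm_le_const fun y hy => ?_
    rw [uIoc_of_le hab] at hy
    have hsR : |s * R| = R := by rw [abs_mul, hs, one_mul, abs_of_nonneg (by linarith)]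
    have := hb (((s * R : ℝ) : ℂ) + y * Complex.I) (by rw [him]; exact hy.1.le)
      (by rw [him]; exact hy.2) (by rw [hre, hsR]; exact hR)
    rwa [hre, hsR] at this
  have key : ∀ R : ℝ, (∫ u in (-R)..R, K (u + a * Complex.I)) -
      (∫ u in (-R)..R, K (u + b * Complex.I)) +
      Complex.I • (∫ y in a..b, K (((1 * R : ℝ) : ℂ) + y * Complex.I)) -
      Complex.I • (∫ y in a..b, K (((-1 * R : ℝ) : ℂ) + y * Complex.I)) = 0 := by
    intro R
    have := Complex.integral_boundary_rect_eq_zero_of_differentiableOn K ⟨-R, a⟩ ⟨R, b⟩ ?_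
    · simpa using this
    · intro w hw
      rw [Complex.mem_reProdIm, uIcc_of_le hab] at hw
      exact (hd w hw.2.1 hw.2.2).differentiableWithinAt
  have hl := (((hlim a le_rfl hab).sub (hlim b hab le_rfl)).add
    ((hside 1 (by norm_num)).const_smul Complex.I)).sub
    ((hside (-1) (by norm_num)).const_smul Complex.I)
  simp only [key, smul_zero, add_zero, sub_zero] at hl
  exact sub_eq_zero.1 (tendsto_nhds_unique hl tendsto_const_nhds)

/-! ### The Gamma integral in logarithmic coordinates -/

lemma integral_Ioi_eq_integral_exp {E : Type*} [NormedAddCommGroup E] [NormedSpace ℝ E]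
    (g : ℝ → E) : ∫ r in Ioi (0 : ℝ), g r = ∫ u : ℝ, Real.exp u • g (Real.exp u) := by
  have := integral_image_eq_integral_abs_deriv_smul (s := univ) (f := Real.exp) (f' := Real.exp)
    MeasurableSet.univ (fun x _ => (Real.hasDerivAt_exp x).hasDerivWithinAt)
    Real.exp_injective.injOn g
  simpa [image_univ, Real.range_exp] using this

lemma integrableOn_Ioi_iff_integrable_exp {E : Type*} [NormedAddCommGroup E] [NormedSpace ℝ E]
    (g : ℝ → E) :
    IntegrableOn g (Ioi 0) ↔ Integrable fun u : ℝ => Real.exp u • g (Real.exp u) := by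
  have := integrableOn_image_iff_integrableOn_abs_deriv_smul (s := univ) (f := Real.exp)
    (f' := Real.exp) MeasurableSet.univ (fun x _ => (Real.hasDerivAt_exp x).hasDerivWithinAt)
    Real.exp_injective.injOn g
  simpa [image_univ, Real.range_exp] using this

lemma exp_smul_rpow_mul_exp (p c u : ℝ) :
    Real.exp u • (Real.exp u ^ (p - 1) * Real.exp (-(c * Real.exp u))) =
      Real.exp (p * u - c * Real.exp u) := by
  rw [smul_eq_mul, ← Real.exp_mul, ← Real.exp_add, ← Real.exp_add]
  ring_nf

lemma integral_exp_mul_sub_exp {p c : ℝ} (hp : 0 < p) (hc : 0 < c) :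
    ∫ u : ℝ, Real.exp (p * u - c * Real.exp u) = (1 / c) ^ p * Real.Gamma p := by
  rw [← Real.integral_rpow_mul_exp_neg_mul_Ioi hp hc, integral_Ioi_eq_integral_exp]
  simp_rw [exp_smul_rpow_mul_exp]

lemma integrable_exp_mul_sub_exp {p c : ℝ} (hp : 0 < p) (hc : 0 < c) :
    Integrable fun u : ℝ => Real.exp (p * u - c * Real.exp u) := by
  have h := integrableOn_rpow_mul_exp_neg_mul_rpow (s := p - 1) (p := 1) (by linarith) one_pos hc
  simp only [Real.rpow_one, neg_mul] at h
  rw [integrableOn_Ioi_iff_integrable_exp] at h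
  simpa only [exp_smul_rpow_mul_exp] using h

lemma norm_cexp_mul_add_exp (p x y : ℝ) :
    ‖Complex.exp (p * (x + y * Complex.I) + Complex.exp (x + y * Complex.I))‖ =
      Real.exp (p * x + Real.cos y * Real.exp x) := by
  rw [Complex.norm_exp]
  congr 1
  simp [Complex.exp_re]
  ring

/-- For `u ≤ 0` the factor `exp (p * u)` already decays. For `u ≥ 0` the bound `u² / 2 ≤ exp u`
leaves a concave quadratic in `u`, and completing the square gives the constant. -/
lemma exp_mul_sub_exp_le {p c : ℝ} (hp : 0 < p) (hc : 0 < c) :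
    ∃ C : ℝ, ∀ u : ℝ, Real.exp (p * u - c * Real.exp u) ≤ C * Real.exp (-(p * |u|)) := by
  refine ⟨Real.exp (2 * p * (2 * p / c)), fun u => ?_⟩
  rw [← Real.exp_add]
  refine Real.exp_le_exp.2 ?_
  have h0 := Real.exp_pos u
  rcases le_total u 0 with h | h
  · rw [abs_of_nonpos h]
    have : 0 ≤ 2 * p * (2 * p / c) := by positivity
    nlinarith [mul_pos hc h0]
  · rw [abs_of_nonneg h]
    have h1 : u ^ 2 / 2 ≤ Real.exp u := by
      have := Real.quadratic_le_exp_of_nonneg h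
      linarith
    have h2 : c * (u ^ 2 / 2) ≤ c * Real.exp u := by gcongr
    have h3 : 2 * p * u - c * (u ^ 2 / 2) ≤ 2 * p * (2 * p / c) := by
      have : 2 * p * (2 * p / c) - (2 * p * u - c * (u ^ 2 / 2)) =
          ((c * u - 2 * p) ^ 2 + (2 * p) ^ 2) / (2 * c) := by
        field_simp
        ring
      have h4 : 0 ≤ ((c * u - 2 * p) ^ 2 + (2 * p) ^ 2) / (2 * c) := by positivity
      linarith
    linarith

/-- The line may be pushed up to height `π`, where `exp w` is the negative real `-exp u` and the
integral is Euler's integral for `Γ(p)`; the phase `exp(iπp)` factors out. -/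
lemma integral_cexp_mul_add_exp {p φ : ℝ} (hp : 0 < p) (h1 : Real.pi / 2 < φ)
    (h2 : φ ≤ Real.pi) :
    ∫ u : ℝ, Complex.exp (p * (u + φ * Complex.I) + Complex.exp (u + φ * Complex.I)) =
      Complex.exp (p * Real.pi * Complex.I) * Real.Gamma p := by
  have hc : 0 < -Real.cos φ := by
    have := Real.cos_neg_of_pi_div_two_lt_of_lt h1 (by linarith [Real.pi_pos])
    linarith
  obtain ⟨C, hC⟩ := exp_mul_sub_exp_le hp hc
  have hcos : ∀ y, φ ≤ y → y ≤ Real.pi → Real.cos y ≤ Real.cos φ := fun y hy hy' =>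
    Real.cos_le_cos_of_nonneg_of_le_pi (by linarith [Real.pi_pos]) hy' hy
  have hK := integral_horizontal_line_eq
    (K := fun w => Complex.exp (p * w + Complex.exp w)) (C := C) h2
    (fun w _ _ => by fun_prop) hp ?_
  · rw [hK]
    have e : ∀ u : ℝ, Complex.exp (p * (u + Real.pi * Complex.I) +
        Complex.exp (u + Real.pi * Complex.I)) = Complex.exp (p * Real.pi * Complex.I) *
          ((Real.exp (p * u - 1 * Real.exp u) : ℝ) : ℂ) := by
      intro u
      rw [Complex.exp_add (u : ℂ), Complex.exp_pi_mul_I, Complex.ofReal_exp, ← Complex.exp_add]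
      congr 1
      push_cast
      ring
    simp_rw [e]
    rw [integral_const_mul, integral_complex_ofReal, integral_exp_mul_sub_exp hp one_pos]
    simp
  · intro w hw1 hw2 _
    have e := norm_cexp_mul_add_exp p w.re w.im
    rw [Complex.re_add_im] at e
    rw [e]
    refine le_trans (Real.exp_le_exp.2 ?_) (hC w.re)
    nlinarith [hcos _ hw1 hw2, Real.exp_pos w.re]

/-! ### Integral representation of the M-Wright function -/

/-- The argument of the rays of the Hankel contour; it satisfies `α φ = π - φ`. -/
noncomputable def wrightAngle (α : ℝ) : ℝ := Real.pi / (1 + α)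

lemma pi_div_two_lt_wrightAngle {α : ℝ} (hα0 : 0 < α) (hα1 : α < 1) :
    Real.pi / 2 < wrightAngle α :=
  div_lt_div_of_pos_left Real.pi_pos (by linarith) (by linarith)

lemma wrightAngle_lt_pi {α : ℝ} (hα0 : 0 < α) : wrightAngle α < Real.pi :=
  div_lt_self Real.pi_pos (by linarith)

lemma mul_wrightAngle {α : ℝ} (hα0 : 0 < α) : α * wrightAngle α = Real.pi - wrightAngle α := by
  have : 1 + α ≠ 0 := by positivity
  rw [wrightAngle]
  field_simp
  ring

/-- The decay rate along the rays of the Hankel contour. -/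
noncomputable def wrightRate (α : ℝ) : ℝ := -Real.cos (wrightAngle α)

lemma wrightRate_pos {α : ℝ} (hα0 : 0 < α) (hα1 : α < 1) : 0 < wrightRate α := by
  have := Real.cos_neg_of_pi_div_two_lt_of_lt (pi_div_two_lt_wrightAngle hα0 hα1)
    (by linarith [Real.pi_pos, wrightAngle_lt_pi hα0])
  rw [wrightRate]
  linarith

lemma cos_wrightAngle (α : ℝ) : Real.cos (wrightAngle α) = -wrightRate α := by
  rw [wrightRate, neg_neg]

lemma cos_mul_wrightAngle {α : ℝ} (hα0 : 0 < α) :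
    Real.cos (α * wrightAngle α) = wrightRate α := by
  rw [mul_wrightAngle hα0, Real.cos_pi_sub, wrightRate]

/-- The integrand of the Hankel integral of `t ^ (-α) * M_α (θ * t ^ (-α))`, in logarithmic
coordinates. -/
noncomputable def wrightIntegrand (α θ t : ℝ) (w : ℂ) : ℂ :=
  Complex.exp (α * w + t * Complex.exp w - θ * Complex.exp (α * w))

/-- The upper ray of the Hankel contour, in logarithmic coordinates. -/
noncomputable def wrightLine (α u : ℝ) : ℂ := u + wrightAngle α * Complex.I

@[fun_prop]
lemma continuous_wrightLine (α : ℝ) : Continuous (wrightLine α) := by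
  unfold wrightLine
  fun_prop

/-- Since `α φ = π - φ`, the factors `exp(tz)` and `exp(-θ z^α)` decay along the ray with the same
constant `wrightRate α`. -/
lemma norm_cexp_wrightLine_exponent {α : ℝ} (hα0 : 0 < α) (p θ t u : ℝ) :
    ‖Complex.exp (p * wrightLine α u + t * Complex.exp (wrightLine α u) -
      θ * Complex.exp (α * wrightLine α u))‖ =
      Real.exp (p * u - t * wrightRate α * Real.exp u -
        θ * wrightRate α * Real.exp (α * u)) := by
  rw [Complex.norm_exp]
  congr 1
  simp [wrightLine, Complex.exp_re, cos_wrightAngle, cos_mul_wrightAngle hα0]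
  ring

lemma norm_wrightIntegrand {α : ℝ} (hα0 : 0 < α) (θ t u : ℝ) :
    ‖wrightIntegrand α θ t (wrightLine α u)‖ =
      Real.exp (α * u - t * wrightRate α * Real.exp u -
        θ * wrightRate α * Real.exp (α * u)) :=
  norm_cexp_wrightLine_exponent hα0 α θ t u

/-- The function `t ^ (-α) * M_α (θ * t ^ (-α))`, as a Hankel integral. -/
noncomputable def wrightDensity (α θ t : ℝ) : ℝ :=
  (∫ u : ℝ, wrightIntegrand α θ t (wrightLine α u)).im / Real.pi

/-- Expand `exp(-θ z^α)` in powers of `θ` and integrate term by term. The `k`-th integral has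
imaginary part `Γ(p) sin(πp)` with `p = α(k + 1)`, which is `π / Γ(1 - p)` by reflection. -/
lemma wrightDensity_one {α : ℝ} (hα0 : 0 < α) (hα1 : α < 1) (θ : ℝ) :
    wrightDensity α θ 1 = mWright α θ := by
  set c := wrightRate α with hc
  have hc0 : 0 < c := wrightRate_pos hα0 hα1
  let F : ℕ → ℝ → ℂ := fun k u => (((-θ) ^ k / k.factorial : ℝ) : ℂ) *
    Complex.exp ((α * (k + 1) : ℝ) * wrightLine α u + Complex.exp (wrightLine α u))
  have hp : ∀ k : ℕ, 0 < α * ((k : ℝ) + 1) := fun k => by positivity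
  have hFnorm : ∀ k u, ‖F k u‖ = |θ| ^ k / k.factorial *
      Real.exp (α * (k + 1) * u - c * Real.exp u) := by
    intro k u
    have := norm_cexp_wrightLine_exponent hα0 (α * (k + 1)) 0 1 u
    simp only [Complex.ofReal_zero, zero_mul, sub_zero, Complex.ofReal_one, one_mul] at this
    simp only [F]
    rw [norm_mul, this, Complex.norm_real, Real.norm_eq_abs, abs_div, abs_pow, abs_neg,
      Nat.abs_cast]
  have hFint : ∀ k, Integrable (F k) := by
    intro k
    refine ((integrable_exp_mul_sub_exp (hp k) hc0).const_mul (|θ| ^ k / k.factorial)).mono'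
      (by unfold F; fun_prop) (Eventually.of_forall fun u => (hFnorm k u).le)
  have hFsum : Summable fun k => ∫ u, ‖F k u‖ := by
    simp_rw [hFnorm, integral_const_mul, integral_exp_mul_sub_exp (hp _) hc0]
    refine ((summable_pow_mul_Gamma_div_factorial hα0 hα1 (|θ| * (1 / c) ^ α)).mul_left
      ((1 / c) ^ α)).congr fun k => ?_
    have : (1 / c) ^ (α * ((k : ℝ) + 1)) = ((1 / c) ^ α) ^ k * (1 / c) ^ α := by
      rw [Real.rpow_mul (by positivity), ← Nat.cast_succ, Real.rpow_natCast, pow_succ]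
    rw [this]
    ring
  have hFval : ∀ k, (∫ u, F k u) = (((-θ) ^ k / k.factorial : ℝ) : ℂ) *
      (Complex.exp ((α * (k + 1) : ℝ) * Real.pi * Complex.I) * Real.Gamma (α * (k + 1))) := by
    intro k
    simp only [F, wrightLine]
    rw [integral_const_mul, integral_cexp_mul_add_exp (hp k)
      (pi_div_two_lt_wrightAngle hα0 hα1) (wrightAngle_lt_pi hα0).le]
  have htsum : ∀ u, ∑' k, F k u = wrightIntegrand α θ 1 (wrightLine α u) := by
    intro u
    set w := wrightLine α u
    have h1 : HasSum (fun k : ℕ => (-θ * Complex.exp (α * w)) ^ k / (k.factorial : ℂ))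
        (Complex.exp (-θ * Complex.exp (α * w))) := by
      rw [Complex.exp_eq_exp_ℂ]
      exact NormedSpace.expSeries_div_hasSum_exp _
    have h2 := (h1.mul_left (Complex.exp (α * w + Complex.exp w))).tsum_eq
    rw [← Complex.exp_add] at h2
    have h3 : wrightIntegrand α θ 1 w =
        Complex.exp (α * w + Complex.exp w + -θ * Complex.exp (α * w)) := by
      rw [wrightIntegrand, Complex.ofReal_one, one_mul, neg_mul, sub_eq_add_neg]
    rw [h3, ← h2]
    refine tsum_congr fun k => ?_
    have h4 : ((α * (k + 1) : ℝ) : ℂ) * w = α * w + k * (α * w) := by push_cast; ring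
    simp only [F]
    rw [h4, mul_pow, ← Complex.exp_nat_mul, Complex.exp_add, Complex.exp_add, Complex.exp_add]
    push_cast
    ring
  have hS := hasSum_integral_of_summable_integral_norm hFint hFsum
  simp_rw [htsum, hFval] at hS
  have hS' := (Complex.hasSum_im hS).div_const Real.pi
  rw [wrightDensity, ← hS'.tsum_eq, mWright]
  refine tsum_congr fun k => ?_
  rw [Complex.im_ofReal_mul, Complex.im_mul_ofReal, ← Complex.ofReal_mul,
    Complex.exp_ofReal_mul_I_im, div_mul_eq_div_div, div_eq_mul_inv _ (Real.Gamma _),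
    inv_Gamma_one_sub_of_pos (hp k)]
  ring_nf

/-- The scaling `z ↦ tz` of the contour is the translation by `log t` in logarithmic coordinates. -/
lemma wrightDensity_eq {α : ℝ} (hα0 : 0 < α) (hα1 : α < 1) (θ : ℝ) {t : ℝ} (ht : 0 < t) :
    wrightDensity α θ t = t ^ (-α) * mWright α (θ * t ^ (-α)) := by
  rw [← wrightDensity_one hα0 hα1, wrightDensity, wrightDensity]
  have e : ∀ u : ℝ, wrightIntegrand α θ t (wrightLine α u) = ((t ^ (-α) : ℝ) : ℂ) *
      wrightIntegrand α (θ * t ^ (-α)) 1 (wrightLine α (u + Real.log t)) := by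
    intro u
    have h1 : wrightLine α (u + Real.log t) = wrightLine α u + Real.log t := by
      simp only [wrightLine]; push_cast; ring
    have h2 : Complex.exp (Real.log t) = t := by
      rw [← Complex.ofReal_exp, Real.exp_log ht]
    have h3 : Complex.exp (α * Real.log t) = ((t ^ α : ℝ) : ℂ) := by
      rw [Real.rpow_def_of_pos ht, mul_comm (Real.log t)]
      push_cast
      rfl
    have h4 : ((t ^ (-α) : ℝ) : ℂ) * ((t ^ α : ℝ) : ℂ) = 1 := by
      rw [← Complex.ofReal_mul, ← Real.rpow_add ht]
      simp
    rw [wrightIntegrand, wrightIntegrand, h1, mul_add, Complex.exp_add _ (Real.log t : ℂ),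
      Complex.exp_add _ (α * Real.log t : ℂ), h2, h3]
    have h5 : (α * wrightLine α u + α * Real.log t +
        (1 : ℝ) * (Complex.exp (wrightLine α u) * t) - (θ * t ^ (-α) : ℝ) *
          (Complex.exp (α * wrightLine α u) * ((t ^ α : ℝ) : ℂ)) : ℂ) =
        α * Real.log t + (α * wrightLine α u + t * Complex.exp (wrightLine α u) -
          θ * Complex.exp (α * wrightLine α u)) := by
      rw [Complex.ofReal_mul θ]
      linear_combination (-(θ : ℂ) * Complex.exp (α * wrightLine α u)) * h4 +
        (Complex.exp (wrightLine α u) * t) * Complex.ofReal_one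
    rw [h5, Complex.exp_add (α * Real.log t : ℂ), h3, ← mul_assoc, h4, one_mul]
  simp_rw [e]
  rw [integral_const_mul, integral_add_right_eq_self
    (fun u => wrightIntegrand α (θ * t ^ (-α)) 1 (wrightLine α u)), Complex.im_ofReal_mul]
  ring

lemma integrable_exp_mul_sub_exp_mul {α c : ℝ} (hα0 : 0 < α) (hc : 0 < c) :
    Integrable fun u : ℝ => Real.exp (α * u - c * Real.exp (α * u)) := by
  simpa using (integrable_exp_mul_sub_exp one_pos hc).comp_mul_left' hα0.ne'

lemma norm_wrightIntegrand_le {α : ℝ} (hα0 : 0 < α) (hα1 : α < 1) {t : ℝ} (ht : 0 ≤ t)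
    (θ u : ℝ) :
    ‖wrightIntegrand α θ t (wrightLine α u)‖ ≤
      Real.exp (α * u - θ * wrightRate α * Real.exp (α * u)) := by
  rw [norm_wrightIntegrand hα0]
  refine Real.exp_le_exp.2 ?_
  have := mul_nonneg (mul_nonneg ht (wrightRate_pos hα0 hα1).le) (Real.exp_pos u).le
  linarith

lemma exists_abs_wrightDensity_le {α : ℝ} (hα0 : 0 < α) (hα1 : α < 1) {θ : ℝ} (hθ : 0 < θ) :
    ∃ B, ∀ t, 0 ≤ t → |wrightDensity α θ t| ≤ B := by
  refine ⟨(∫ u : ℝ, Real.exp (α * u - θ * wrightRate α * Real.exp (α * u))) / Real.pi,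
    fun t ht => ?_⟩
  rw [wrightDensity, abs_div, abs_of_pos Real.pi_pos]
  gcongr
  refine (Complex.abs_im_le_norm _).trans ?_
  exact norm_integral_le_of_norm_le
    (integrable_exp_mul_sub_exp_mul hα0 (mul_pos hθ (wrightRate_pos hα0 hα1)))
    (Eventually.of_forall fun u => norm_wrightIntegrand_le hα0 hα1 ht θ u)

lemma continuousOn_wrightDensity {α : ℝ} (hα0 : 0 < α) (hα1 : α < 1) {θ : ℝ} (hθ : 0 < θ) :
    ContinuousOn (wrightDensity α θ) (Ici 0) := by
  refine (Complex.continuous_im.comp_continuousOn ?_).div_const _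
  refine continuousOn_of_dominated
    (bound := fun u => Real.exp (α * u - θ * wrightRate α * Real.exp (α * u))) ?_ ?_
    (integrable_exp_mul_sub_exp_mul hα0 (mul_pos hθ (wrightRate_pos hα0 hα1))) ?_
  · intro t _
    unfold wrightIntegrand
    fun_prop
  · exact fun t ht => Eventually.of_forall fun u => norm_wrightIntegrand_le hα0 hα1 ht θ u
  · refine Eventually.of_forall fun u => ?_
    unfold wrightIntegrand
    fun_prop

/-! ### The Laplace transform of the Hankel integral -/

/-- The factor with `θ` has norm at most one and is dropped. The remaining integral over `u` is a
multiple of `t ^ (-α)`, and `exp (-t) * t ^ (-α)` is integrable because `α < 1`. The case `θ = 0` is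
included and needed later. -/
lemma integrable_exp_neg_mul_wrightIntegrand {α : ℝ} (hα0 : 0 < α) (hα1 : α < 1) {θ : ℝ}
    (hθ : 0 ≤ θ) :
    Integrable (fun p : ℝ × ℝ => (Real.exp (-p.1) : ℂ) *
      wrightIntegrand α θ p.1 (wrightLine α p.2)) ((volume.restrict (Ioi 0)).prod volume) := by
  have hc := wrightRate_pos hα0 hα1
  set c := wrightRate α with hcdef
  have hdom : Integrable (fun p : ℝ × ℝ => Real.exp (-p.1) *
      Real.exp (α * p.2 - p.1 * c * Real.exp p.2)) ((volume.restrict (Ioi 0)).prod volume) := by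
    rw [integrable_prod_iff (by fun_prop)]
    constructor
    · filter_upwards [ae_restrict_mem measurableSet_Ioi] with t ht
      exact (integrable_exp_mul_sub_exp hα0 (mul_pos ht hc)).const_mul _
    · have h := (Real.GammaIntegral_convergent (sub_pos.2 hα1)).const_mul
        ((1 / c) ^ α * Real.Gamma α)
      refine h.congr ?_
      filter_upwards [ae_restrict_mem measurableSet_Ioi] with t ht
      have ht' : 0 < t := ht
      simp_rw [Real.norm_of_nonneg (mul_nonneg (Real.exp_pos _).le (Real.exp_pos _).le)]
      rw [integral_const_mul, integral_exp_mul_sub_exp hα0 (mul_pos ht' hc),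
        Real.div_rpow zero_le_one hc.le, Real.div_rpow zero_le_one (mul_pos ht' hc).le,
        Real.one_rpow, Real.mul_rpow ht'.le hc.le, sub_sub_cancel_left, Real.rpow_neg ht'.le,
        one_div, one_div, mul_inv]
      ring
  refine hdom.mono' ?_ ?_
  · unfold wrightIntegrand
    fun_prop
  · have : ∀ᵐ p : ℝ × ℝ ∂((volume.restrict (Ioi 0)).prod volume), p.1 ∈ Ioi (0 : ℝ) :=
      Measure.quasiMeasurePreserving_fst.ae (ae_restrict_mem measurableSet_Ioi)
    filter_upwards [this] with p hp
    rw [norm_mul, Complex.norm_real, Real.norm_of_nonneg (Real.exp_pos _).le,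
      norm_wrightIntegrand hα0]
    refine mul_le_mul_of_nonneg_left (Real.exp_le_exp.2 ?_) (Real.exp_pos _).le
    exact sub_le_self _ (mul_nonneg (mul_nonneg hθ hc.le) (Real.exp_pos _).le)

lemma re_cexp_wrightLine (α u : ℝ) :
    (Complex.exp (wrightLine α u)).re = -wrightRate α * Real.exp u := by
  simp [wrightLine, Complex.exp_re, cos_wrightAngle]
  ring

/-- The Laplace transform at `1` of the integrand of the Hankel integral. -/
noncomputable def wrightResolvent (α θ : ℝ) (w : ℂ) : ℂ :=
  Complex.exp (α * w - θ * Complex.exp (α * w)) / (1 - Complex.exp w)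

lemma setIntegral_exp_neg_mul_wrightIntegrand {α : ℝ} (hα0 : 0 < α) (hα1 : α < 1) (θ u : ℝ) :
    ∫ t in Ioi (0 : ℝ), (Real.exp (-t) : ℂ) * wrightIntegrand α θ t (wrightLine α u) =
      wrightResolvent α θ (wrightLine α u) := by
  set w := wrightLine α u
  have hre : (Complex.exp w - 1).re < 0 := by
    rw [Complex.sub_re, re_cexp_wrightLine, Complex.one_re]
    have := mul_pos (wrightRate_pos hα0 hα1) (Real.exp_pos u)
    linarith
  have e : ∀ t : ℝ, (Real.exp (-t) : ℂ) * wrightIntegrand α θ t w =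
      Complex.exp (α * w - θ * Complex.exp (α * w)) * Complex.exp ((Complex.exp w - 1) * t) := by
    intro t
    rw [wrightIntegrand, Complex.ofReal_exp, ← Complex.exp_add, ← Complex.exp_add]
    congr 1
    push_cast
    ring
  simp_rw [e]
  rw [integral_const_mul, integral_exp_mul_complex_Ioi hre, wrightResolvent]
  simp only [Complex.ofReal_zero, mul_zero, Complex.exp_zero]
  rw [div_eq_mul_inv _ (1 - Complex.exp w), ← neg_sub (Complex.exp w) 1, neg_div, one_div, inv_neg]

lemma integrable_wrightResolvent {α : ℝ} (hα0 : 0 < α) (hα1 : α < 1) {θ : ℝ} (hθ : 0 ≤ θ) :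
    Integrable fun u : ℝ => wrightResolvent α θ (wrightLine α u) := by
  have h := (integrable_exp_neg_mul_wrightIntegrand hα0 hα1 hθ).integral_prod_right
  simpa only [setIntegral_exp_neg_mul_wrightIntegrand hα0 hα1] using h

lemma setIntegral_exp_neg_mul_wrightDensity {α : ℝ} (hα0 : 0 < α) (hα1 : α < 1) {θ : ℝ}
    (hθ : 0 ≤ θ) :
    ∫ t in Ioi (0 : ℝ), Real.exp (-t) * wrightDensity α θ t =
      (∫ u : ℝ, wrightResolvent α θ (wrightLine α u)).im / Real.pi := by
  have hint := integrable_exp_neg_mul_wrightIntegrand hα0 hα1 hθ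
  have h := integral_integral_swap (f := fun t u => (Real.exp (-t) : ℂ) *
      wrightIntegrand α θ t (wrightLine α u)) hint
  simp_rw [setIntegral_exp_neg_mul_wrightIntegrand hα0 hα1] at h
  have him := integral_im (𝕜 := ℂ) hint.integral_prod_left
  simp only [RCLike.im_to_complex] at him
  rw [← h, ← him, ← integral_div]
  refine integral_congr_ae (Eventually.of_forall fun t => ?_)
  simp only [wrightDensity]
  rw [integral_const_mul, Complex.im_ofReal_mul]
  ring

/-! ### Evaluation of the Laplace transform by Cauchy's theorem -/

/-- Subtracting `exp(-θ)` times the case `θ = 0` makes the numerator vanish at `w = 0`, which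
cancels the pole there. -/
lemma wrightResolvent_sub_eq (α θ : ℝ) (w : ℂ) :
    wrightResolvent α θ w - Real.exp (-θ) * wrightResolvent α 0 w =
      Complex.exp (α * w) * (Complex.exp (-θ * Complex.exp (α * w)) - Complex.exp (-θ)) /
        (1 - Complex.exp w) := by
  simp only [wrightResolvent]
  rw [sub_eq_add_neg _ ((θ : ℂ) * _), Complex.exp_add]
  push_cast
  simp only [zero_mul, sub_zero, neg_mul]
  ring

lemma norm_wrightResolvent_sub_le {α : ℝ} (hα0 : 0 < α) (hα1 : α < 1) {θ : ℝ} (hθ : 0 ≤ θ)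
    {w : ℂ} (h0 : 0 ≤ w.im) (h1 : w.im ≤ wrightAngle α) (hre : 1 ≤ |w.re|) :
    ‖wrightResolvent α θ w - Real.exp (-θ) * wrightResolvent α 0 w‖ ≤
      4 * Real.exp (-(min α (1 - α) * |w.re|)) := by
  have hnum : ‖Complex.exp (-θ * Complex.exp (α * w)) - Complex.exp (-θ)‖ ≤ 2 := by
    refine (norm_sub_le _ _).trans ?_
    -- In the strip, `α * w.im ≤ α φ = π - φ < π / 2`.
    have hcos : 0 ≤ Real.cos (α * w.im) := by
      refine Real.cos_nonneg_of_neg_pi_div_two_le_of_le ?_ ?_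
      · have := mul_nonneg hα0.le h0
        linarith [Real.pi_pos]
      · have := mul_le_mul_of_nonneg_left h1 hα0.le
        rw [mul_wrightAngle hα0] at this
        linarith [pi_div_two_lt_wrightAngle hα0 hα1]
    have e1 : ‖Complex.exp (-θ * Complex.exp (α * w))‖ ≤ 1 := by
      rw [Complex.norm_exp, Real.exp_le_one_iff]
      have : 0 ≤ θ * (Real.exp (α * w.re) * Real.cos (α * w.im)) := by positivity
      simpa [Complex.exp_re] using this
    have e2 : ‖Complex.exp (-θ : ℂ)‖ ≤ 1 := by
      rw [Complex.norm_exp, Real.exp_le_one_iff]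
      simpa using hθ
    linarith
  have hα : ‖Complex.exp (α * w)‖ = Real.exp (α * w.re) := by
    rw [Complex.norm_exp]; simp
  have hew : ‖Complex.exp w‖ = Real.exp w.re := Complex.norm_exp w
  rw [wrightResolvent_sub_eq, norm_div, norm_mul, hα]
  -- It remains to bound the denominator below: by `exp w.re / 2` on the right, leaving decay rate
  -- `1 - α`, and by `1 / 2` on the left, leaving decay rate `α`.
  have key : ∀ d : ℝ, 0 < d → d ≤ ‖1 - Complex.exp w‖ →
      Real.exp (α * w.re) * 2 / d ≤ 4 * Real.exp (-(min α (1 - α) * |w.re|)) →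
      Real.exp (α * w.re) * ‖Complex.exp (-θ * Complex.exp (α * w)) - Complex.exp (-θ)‖ /
        ‖1 - Complex.exp w‖ ≤ 4 * Real.exp (-(min α (1 - α) * |w.re|)) := by
    intro d hd0 hd h
    refine le_trans ?_ h
    gcongr
  have hexp1 : (2 : ℝ) ≤ Real.exp 1 := by
    have := Real.add_one_le_exp (1 : ℝ)
    linarith
  rcases le_total 0 w.re with hs | hs
  · have hab := abs_of_nonneg hs
    rw [hab] at hre
    have h2 : 2 ≤ Real.exp w.re := hexp1.trans (Real.exp_le_exp.2 hre)
    refine key (Real.exp w.re / 2) (by positivity) ?_ ?_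
    · have := norm_sub_norm_le (Complex.exp w) 1
      rw [norm_sub_rev, hew, norm_one] at this
      linarith
    · have : Real.exp (α * w.re) * 2 / (Real.exp w.re / 2) =
          4 * Real.exp (-((1 - α) * w.re)) := by
        rw [show -((1 - α) * w.re) = α * w.re - w.re by ring, Real.exp_sub]
        ring
      rw [this, hab]
      gcongr
      exact min_le_right _ _
  · have hab := abs_of_nonpos hs
    rw [hab] at hre
    have h2 : Real.exp w.re ≤ 1 / 2 := by
      have h3 : Real.exp 1 ≤ Real.exp (-w.re) := Real.exp_le_exp.2 hre
      rw [Real.exp_neg] at h3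
      rw [one_div]
      exact (le_inv_comm₀ (by norm_num) (Real.exp_pos _)).1 (hexp1.trans h3)
    refine key (1 / 2) (by positivity) ?_ ?_
    · have := norm_sub_norm_le 1 (Complex.exp w)
      rw [hew, norm_one] at this
      linarith
    · have : Real.exp (α * w.re) * 2 / (1 / 2) = 4 * Real.exp (-(α * -w.re)) := by
        rw [mul_neg, neg_neg]
        ring
      rw [this, hab]
      gcongr
      exact min_le_left _ _

lemma dslope_exp_zero_ne_zero {w : ℂ} (h0 : 0 ≤ w.im) (h1 : w.im < Real.pi) :
    dslope Complex.exp 0 w ≠ 0 := by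
  rcases eq_or_ne w 0 with rfl | hw
  · rw [dslope_same, Complex.deriv_exp, Complex.exp_zero]
    exact one_ne_zero
  · rw [dslope_of_ne _ hw, slope_def_field, Complex.exp_zero]
    refine div_ne_zero (fun h => hw ?_) (by simpa using hw)
    obtain ⟨n, hn⟩ := Complex.exp_eq_one_iff.1 (sub_eq_zero.1 h)
    have him : w.im = n * (2 * Real.pi) := by
      have := congrArg Complex.im hn
      simpa using this
    have hpi := Real.pi_pos
    have hn0 : n = 0 := by
      have a1 : (-1 : ℝ) < n := by
        by_contra hh
        nlinarith
      have a2 : (n : ℝ) < 1 := by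
        by_contra hh
        nlinarith
      have a3 : -1 < n := by exact_mod_cast a1
      have a4 : n < 1 := by exact_mod_cast a2
      omega
    rw [hn, hn0]
    simp

/-- With the pole removed, the line can be lowered to the real axis, where the integrand is real. -/
lemma integral_wrightResolvent_sub_im {α : ℝ} (hα0 : 0 < α) (hα1 : α < 1) {θ : ℝ} (hθ : 0 ≤ θ) :
    (∫ u : ℝ, (wrightResolvent α θ (wrightLine α u) -
      Real.exp (-θ) * wrightResolvent α 0 (wrightLine α u))).im = 0 := by
  have hφ0 : 0 < wrightAngle α := by
    linarith [pi_div_two_lt_wrightAngle hα0 hα1, Real.pi_pos]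
  let F : ℂ → ℂ := fun w =>
    Complex.exp (α * w) * (Complex.exp (-θ * Complex.exp (α * w)) - Complex.exp (-θ))
  -- `F` and `exp - 1` both vanish at `0`, so this quotient of slopes extends `F / (1 - exp)`
  -- holomorphically across `0`.
  let K : ℂ → ℂ := fun w => -(dslope F 0 w / dslope Complex.exp 0 w)
  have hF0 : F 0 = 0 := by simp [F]
  have hentire : ∀ f : ℂ → ℂ, Differentiable ℂ f → Differentiable ℂ (dslope f 0) := fun f hf =>
    differentiableOn_univ.1 ((Complex.differentiableOn_dslope univ_mem).2 hf.differentiableOn)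
  have hdF : Differentiable ℂ (dslope F 0) := hentire F (by unfold F; fun_prop)
  have hdE : Differentiable ℂ (dslope Complex.exp 0) := hentire _ Complex.differentiable_exp
  have hKeq : ∀ w, w ≠ 0 → K w =
      wrightResolvent α θ w - Real.exp (-θ) * wrightResolvent α 0 w := by
    intro w hw
    simp only [K]
    rw [wrightResolvent_sub_eq, dslope_of_ne _ hw, dslope_of_ne _ hw, slope_def_field,
      slope_def_field, hF0, Complex.exp_zero, sub_zero, sub_zero, div_div_div_cancel_right₀ hw,
      ← neg_sub (Complex.exp w) 1, div_neg]
  have hline : ∀ u, wrightLine α u ≠ 0 := by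
    intro u h
    have := congrArg Complex.im h
    simp [wrightLine] at this
    exact hφ0.ne' this
  have hshift := integral_horizontal_line_eq (K := K) hφ0.le (C := 4)
    (δ := min α (1 - α)) ?_ (lt_min hα0 (sub_pos.2 hα1)) ?_
  · have h1 : ∫ u : ℝ, (wrightResolvent α θ (wrightLine α u) -
        Real.exp (-θ) * wrightResolvent α 0 (wrightLine α u)) = ∫ u : ℝ, K (wrightLine α u) :=
      integral_congr_ae (Eventually.of_forall fun u => (hKeq _ (hline u)).symm)
    have h2 : ∫ u : ℝ, K (u + (0 : ℝ) * Complex.I) =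
        ∫ u : ℝ, (((Real.exp (α * u) * (Real.exp (-θ * Real.exp (α * u)) - Real.exp (-θ)) /
          (1 - Real.exp u) : ℝ)) : ℂ) := by
      refine integral_congr_ae ?_
      filter_upwards [Measure.ae_ne volume (0 : ℝ)] with u hu
      rw [Complex.ofReal_zero, zero_mul, add_zero, hKeq _ (by exact_mod_cast hu),
        wrightResolvent_sub_eq]
      push_cast
      rfl
    rw [h1]
    unfold wrightLine
    rw [← hshift, h2, integral_complex_ofReal, Complex.ofReal_im]
  · intro w h0 h1
    exact ((hdF w).div (hdE w)
      (dslope_exp_zero_ne_zero h0 (h1.trans_lt (wrightAngle_lt_pi hα0)))).neg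
  · intro w h0 h1 hre
    rw [hKeq w (by rintro rfl; simp at hre; linarith)]
    exact norm_wrightResolvent_sub_le hα0 hα1 hθ h0 h1 hre

lemma mWright_zero (α : ℝ) : mWright α 0 = (Real.Gamma (1 - α))⁻¹ := by
  rw [mWright, tsum_eq_single 0]
  · simp
  · intro k hk
    simp [hk]

lemma laplace_wrightDensity_one {α : ℝ} (hα0 : 0 < α) (hα1 : α < 1) {θ : ℝ} (hθ : 0 ≤ θ) :
    ∫ t in Ioi (0 : ℝ), Real.exp (-t) * wrightDensity α θ t = Real.exp (-θ) := by
  -- At `θ = 0` the density is `t ^ (-α) / Γ(1 - α)`, so the integral is Euler's; this fixes the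
  -- constant that the comparison leaves open.
  have h0 : ∫ t in Ioi (0 : ℝ), Real.exp (-t) * wrightDensity α 0 t = 1 := by
    have hG := Real.Gamma_pos_of_pos (sub_pos.2 hα1)
    have e : ∫ t in Ioi (0 : ℝ), Real.exp (-t) * wrightDensity α 0 t =
        ∫ t in Ioi (0 : ℝ), (Real.exp (-t) * t ^ (1 - α - 1)) * (Real.Gamma (1 - α))⁻¹ := by
      refine setIntegral_congr_fun measurableSet_Ioi fun t ht => ?_
      rw [wrightDensity_eq hα0 hα1 0 ht, zero_mul, mWright_zero, sub_sub_cancel_left]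
      ring
    rw [e, integral_mul_const, ← Real.Gamma_eq_integral (sub_pos.2 hα1), mul_inv_cancel₀ hG.ne']
  have h1 := integral_wrightResolvent_sub_im hα0 hα1 hθ
  rw [integral_sub (integrable_wrightResolvent hα0 hα1 hθ)
    ((integrable_wrightResolvent hα0 hα1 le_rfl).const_mul _), integral_const_mul,
    Complex.sub_im, Complex.im_ofReal_mul] at h1
  rw [setIntegral_exp_neg_mul_wrightDensity hα0 hα1 le_rfl] at h0
  rw [setIntegral_exp_neg_mul_wrightDensity hα0 hα1 hθ, sub_eq_zero.1 h1, mul_div_assoc, h0,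
    mul_one]

lemma wrightDensity_mul {α : ℝ} (hα0 : 0 < α) (hα1 : α < 1) (θ : ℝ) {s t : ℝ} (hs : 0 < s)
    (ht : 0 < t) :
    wrightDensity α θ t = s ^ α * wrightDensity α (θ * s ^ α) (s * t) := by
  have h : s ^ (-α) = (s ^ α)⁻¹ := Real.rpow_neg hs.le _
  have h0 : s ^ α ≠ 0 := (Real.rpow_pos_of_pos hs _).ne'
  rw [wrightDensity_eq hα0 hα1 θ ht, wrightDensity_eq hα0 hα1 _ (mul_pos hs ht),
    Real.mul_rpow hs.le ht.le, h, ← mul_assoc (θ * s ^ α), mul_assoc θ, mul_inv_cancel₀ h0, mul_one,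
    ← mul_assoc, ← mul_assoc, mul_inv_cancel₀ h0, one_mul]

lemma laplace_wrightDensity {α : ℝ} (hα0 : 0 < α) (hα1 : α < 1) {θ : ℝ} (hθ : 0 ≤ θ) {s : ℝ}
    (hs : 0 < s) :
    ∫ t in Ioi (0 : ℝ), Real.exp (-(s * t)) * wrightDensity α θ t =
      s ^ (α - 1) * Real.exp (-(θ * s ^ α)) := by
  have e : ∫ t in Ioi (0 : ℝ), Real.exp (-(s * t)) * wrightDensity α θ t =
      ∫ t in Ioi (0 : ℝ), s ^ α * (Real.exp (-(s * t)) * wrightDensity α (θ * s ^ α) (s * t)) := by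
    refine setIntegral_congr_fun measurableSet_Ioi fun t ht => ?_
    rw [wrightDensity_mul hα0 hα1 θ hs ht]
    ring
  rw [e, integral_const_mul,
    integral_comp_mul_left_Ioi (fun t => Real.exp (-t) * wrightDensity α (θ * s ^ α) t) 0 hs,
    mul_zero, laplace_wrightDensity_one hα0 hα1 (mul_nonneg hθ (Real.rpow_nonneg hs.le _)),
    Real.rpow_sub hs, Real.rpow_one, smul_eq_mul]
  ring

/-! ### Functions whose derivatives alternate in sign -/

/-- The first `n` derivatives of `f` on `(0, ∞)` exist and alternate in sign. -/
def AlternatingDerivs : ℕ → (ℝ → ℝ) → Prop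
  | 0, f => ∀ s, 0 < s → 0 ≤ f s
  | n + 1, f => (∀ s, 0 < s → 0 ≤ f s) ∧
      ∃ g : ℝ → ℝ, (∀ s, 0 < s → HasDerivAt f (-g s) s) ∧ AlternatingDerivs n g

namespace AlternatingDerivs

lemma pred {n : ℕ} {f : ℝ → ℝ} (hf : AlternatingDerivs (n + 1) f) : AlternatingDerivs n f := by
  induction n generalizing f with
  | zero => exact hf.1
  | succ n ih =>
    obtain ⟨h0, g, hg, hn⟩ := hf
    exact ⟨h0, g, hg, ih hn⟩

lemma add {n : ℕ} {f g : ℝ → ℝ} (hf : AlternatingDerivs n f) (hg : AlternatingDerivs n g) :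
    AlternatingDerivs n (fun s => f s + g s) := by
  induction n generalizing f g with
  | zero => exact fun s hs => add_nonneg (hf s hs) (hg s hs)
  | succ n ih =>
    obtain ⟨hf0, f', hf', hfn⟩ := hf
    obtain ⟨hg0, g', hg', hgn⟩ := hg
    refine ⟨fun s hs => add_nonneg (hf0 s hs) (hg0 s hs), _, fun s hs => ?_, ih hfn hgn⟩
    rw [neg_add]
    exact (hf' s hs).add (hg' s hs)

lemma mul {n : ℕ} {f g : ℝ → ℝ} (hf : AlternatingDerivs n f) (hg : AlternatingDerivs n g) :
    AlternatingDerivs n (fun s => f s * g s) := by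
  induction n generalizing f g with
  | zero => exact fun s hs => mul_nonneg (hf s hs) (hg s hs)
  | succ n ih =>
    have hf1 := hf.pred
    have hg1 := hg.pred
    obtain ⟨hf0, f', hf', hfn⟩ := hf
    obtain ⟨hg0, g', hg', hgn⟩ := hg
    refine ⟨fun s hs => mul_nonneg (hf0 s hs) (hg0 s hs), _, fun s hs => ?_,
      (ih hfn hg1).add (ih hf1 hgn)⟩
    exact ((hf' s hs).mul (hg' s hs)).congr_deriv (by ring)

lemma const_mul_rpow (n : ℕ) {c q : ℝ} (hc : 0 ≤ c) (hq : q ≤ 0) :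
    AlternatingDerivs n (fun s => c * s ^ q) := by
  induction n generalizing c q with
  | zero => exact fun s hs => mul_nonneg hc (Real.rpow_nonneg hs.le _)
  | succ n ih =>
    refine ⟨fun s hs => mul_nonneg hc (Real.rpow_nonneg hs.le _), _, fun s hs => ?_,
      ih (c := c * -q) (q := q - 1) (by nlinarith) (by linarith)⟩
    exact ((Real.hasDerivAt_rpow_const (p := q) (Or.inl hs.ne')).const_mul c).congr_deriv (by ring)

lemma exp_neg_mul_rpow (n : ℕ) {α θ : ℝ} (hα0 : 0 < α) (hα1 : α < 1) (hθ : 0 ≤ θ) :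
    AlternatingDerivs n (fun s => Real.exp (-(θ * s ^ α))) := by
  induction n with
  | zero => exact fun s hs => (Real.exp_pos _).le
  | succ n ih =>
    refine ⟨fun s hs => (Real.exp_pos _).le, _, fun s hs => ?_,
      (const_mul_rpow n (c := θ * α) (q := α - 1) (by positivity) (by linarith)).mul ih⟩
    have h : HasDerivAt (fun s : ℝ => -(θ * s ^ α)) (-(θ * (α * s ^ (α - 1)))) s :=
      ((Real.hasDerivAt_rpow_const (p := α) (Or.inl hs.ne')).const_mul θ).neg
    exact h.exp.congr_deriv (by ring)

/-- Uniqueness of derivatives identifies the abstract derivatives of `f` with the explicit family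
`F`; in the application `F` consists of the moment integrals obtained by differentiating a Laplace
transform. -/
lemma nonneg_of_hasDerivAt {F : ℕ → ℝ → ℝ}
    (hF : ∀ k s, 0 < s → HasDerivAt (F k) (-F (k + 1) s) s) {n k : ℕ} {f : ℝ → ℝ}
    (hf : AlternatingDerivs n f) (hfF : ∀ s, 0 < s → f s = F k s) :
    ∀ s, 0 < s → 0 ≤ F (k + n) s := by
  induction n generalizing k f with
  | zero => exact fun s hs => hfF s hs ▸ hf s hs
  | succ n ih =>
    obtain ⟨_, g, hg, hgn⟩ := hf
    intro s hs
    rw [← Nat.add_assoc, Nat.add_right_comm]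
    refine ih (k := k + 1) hgn (fun x hx => ?_) s hs
    have he : f =ᶠ[𝓝 x] F k := by
      filter_upwards [lt_mem_nhds hx] with y hy using hfF y hy
    exact neg_injective ((hg x hx).unique ((hF k x hx).congr_of_eventuallyEq he))

end AlternatingDerivs

/-! ### Positivity from the Laplace transform -/

lemma integrableOn_pow_mul_exp_neg_mul (n : ℕ) {s : ℝ} (hs : 0 < s) :
    IntegrableOn (fun t : ℝ => t ^ n * Real.exp (-(s * t))) (Ioi 0) := by
  have h := integrableOn_rpow_mul_exp_neg_mul_rpow (s := n) (p := 1)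
    (by linarith [Nat.cast_nonneg (α := ℝ) n]) one_pos hs
  simpa only [Real.rpow_one, neg_mul, Real.rpow_natCast] using h

lemma integral_pow_mul_exp_neg_mul (n : ℕ) {s : ℝ} (hs : 0 < s) :
    ∫ t in Ioi (0 : ℝ), t ^ n * Real.exp (-(s * t)) = n.factorial / s ^ (n + 1) := by
  have h := Real.integral_rpow_mul_exp_neg_mul_Ioi (a := n + 1) (by positivity) hs
  simp only [add_sub_cancel_right, Real.rpow_natCast] at h
  rw [h, Real.Gamma_nat_eq_factorial, ← Nat.cast_succ, Real.rpow_natCast, one_div, inv_pow,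
    div_eq_inv_mul]

lemma integrableOn_pow_mul_exp_neg_mul_mul (n : ℕ) {s : ℝ} (hs : 0 < s) {h : ℝ → ℝ} {B : ℝ}
    (hc : ContinuousOn h (Ioi 0)) (hB : ∀ t, 0 < t → |h t| ≤ B) :
    IntegrableOn (fun t : ℝ => t ^ n * Real.exp (-(s * t)) * h t) (Ioi 0) := by
  refine ((integrableOn_pow_mul_exp_neg_mul n hs).mul_const B).mono' ?_ ?_
  · exact (Continuous.aestronglyMeasurable (by fun_prop)).mul
      (hc.aestronglyMeasurable measurableSet_Ioi)
  · filter_upwards [ae_restrict_mem measurableSet_Ioi] with t ht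
    have ht' : 0 < t := ht
    rw [norm_mul, Real.norm_of_nonneg (by positivity : 0 ≤ t ^ n * Real.exp (-(s * t)))]
    exact mul_le_mul_of_nonneg_left (hB t ht) (by positivity)

lemma hasDerivAt_integral_pow_mul_exp_neg_mul (n : ℕ) {s : ℝ} (hs : 0 < s) {h : ℝ → ℝ} {B : ℝ}
    (hc : ContinuousOn h (Ioi 0)) (hB : ∀ t, 0 < t → |h t| ≤ B) :
    HasDerivAt (fun s : ℝ => ∫ t in Ioi (0 : ℝ), t ^ n * Real.exp (-(s * t)) * h t)
      (-∫ t in Ioi (0 : ℝ), t ^ (n + 1) * Real.exp (-(s * t)) * h t) s := by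
  have hmeas : ∀ (m : ℕ) (x : ℝ), AEStronglyMeasurable
      (fun t : ℝ => t ^ m * Real.exp (-(x * t)) * h t) (volume.restrict (Ioi 0)) := fun m x =>
    (Continuous.aestronglyMeasurable (by fun_prop)).mul
      (hc.aestronglyMeasurable measurableSet_Ioi)
  rw [← integral_neg]
  refine (hasDerivAt_integral_of_dominated_loc_of_deriv_le (μ := volume.restrict (Ioi 0))
    (F' := fun x t => -(t ^ (n + 1) * Real.exp (-(x * t)) * h t))
    (s := Ioi (s / 2)) (bound := fun t => t ^ (n + 1) * Real.exp (-(s / 2 * t)) * B)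
    (Ioi_mem_nhds (by linarith)) (Eventually.of_forall fun x => hmeas n x)
    (integrableOn_pow_mul_exp_neg_mul_mul n hs hc hB) (hmeas (n + 1) s).neg ?_
    ((integrableOn_pow_mul_exp_neg_mul (n + 1) (by linarith)).mul_const B) ?_).2
  · filter_upwards [ae_restrict_mem measurableSet_Ioi] with t ht x hx
    have ht' : 0 < t := ht
    have hx' : s / 2 < x := hx
    rw [norm_neg, norm_mul,
      Real.norm_of_nonneg (by positivity : 0 ≤ t ^ (n + 1) * Real.exp (-(x * t))), Real.norm_eq_abs]
    have := hB t ht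
    have : 0 ≤ |h t| := abs_nonneg _
    gcongr
  · refine Eventually.of_forall fun t x _ => ?_
    have h1 : HasDerivAt (fun x : ℝ => -(x * t)) (-(1 * t)) x := ((hasDerivAt_id x).mul_const t).neg
    exact ((h1.exp.const_mul (t ^ n)).mul_const (h t)).congr_deriv (by ring)

/-- The kernel `t ^ n * exp (-(s * t))` with `s = n / a` concentrates at `a` as `n` grows. If `h a <
0`, a Chebyshev estimate makes the integral negative for large `n`. -/
lemma nonneg_of_forall_integral_pow_mul_exp_nonneg {h : ℝ → ℝ} {B : ℝ}
    (hc : ContinuousOn h (Ioi 0)) (hB : ∀ t, 0 < t → |h t| ≤ B)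
    (hpos : ∀ (n : ℕ) (s : ℝ), 0 < s →
      0 ≤ ∫ t in Ioi (0 : ℝ), t ^ n * Real.exp (-(s * t)) * h t)
    {a : ℝ} (ha : 0 < a) : 0 ≤ h a := by
  by_contra! hneg
  set η := -h a / 2 with hη
  have hη0 : 0 < η := by linarith
  have hB0 : 0 ≤ B := (abs_nonneg _).trans (hB a ha)
  obtain ⟨δ, hδ0, hδ⟩ := Metric.continuousAt_iff.1 (hc.continuousAt (Ioi_mem_nhds ha)) η hη0
  set D := (B + η) / δ ^ 2 with hD
  have hD0 : 0 < D := by positivity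
  -- A parabola above `h`: near `a` continuity gives `h t < h a + η = -η`, and at distance at least
  -- `δ` the choice of `D` makes the quadratic term absorb `B + η`.
  have hle : ∀ t, 0 < t → h t ≤ -η + D * (t - a) ^ 2 := by
    intro t ht
    rcases lt_or_ge |t - a| δ with hd | hd
    · have h1 := hδ (x := t) (by rwa [Real.dist_eq])
      rw [Real.dist_eq] at h1
      have h2 := (abs_lt.1 h1).2
      have h3 : 0 ≤ D * (t - a) ^ 2 := by positivity
      linarith
    · have h1 : δ ^ 2 ≤ (t - a) ^ 2 := by
        rw [← sq_abs (t - a)]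
        gcongr
      have h2 : B + η ≤ D * (t - a) ^ 2 := by
        rw [hD, div_mul_eq_mul_div, le_div_iff₀ (by positivity)]
        gcongr
      linarith [(abs_le.1 (hB t ht)).2]
  obtain ⟨n, hn⟩ := exists_nat_gt (max 1 (3 * D * a ^ 2 / η))
  have hn1 : (1 : ℝ) < n := (le_max_left _ _).trans_lt hn
  have hn2 : 3 * D * a ^ 2 < n * η := by
    rw [← div_lt_iff₀ hη0]
    exact (le_max_right _ _).trans_lt hn
  have hn0 : (0 : ℝ) < n := by linarith
  set s : ℝ := n / a with hs
  have hs0 : 0 < s := by positivity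
  have hI := fun m => integrableOn_pow_mul_exp_neg_mul m hs0
  have hI' : IntegrableOn (fun t : ℝ => (D * a ^ 2 - η) * (t ^ n * Real.exp (-(s * t))) +
      D * (t ^ (n + 2) * Real.exp (-(s * t)))) (Ioi 0) :=
    ((hI n).const_mul _).add ((hI (n + 2)).const_mul _)
  have h1 : ∫ t in Ioi (0 : ℝ), t ^ n * Real.exp (-(s * t)) * h t ≤
      ∫ t in Ioi (0 : ℝ), ((D * a ^ 2 - η) * (t ^ n * Real.exp (-(s * t))) +
        D * (t ^ (n + 2) * Real.exp (-(s * t))) -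
        2 * a * D * (t ^ (n + 1) * Real.exp (-(s * t)))) := by
    refine setIntegral_mono_on (integrableOn_pow_mul_exp_neg_mul_mul n hs0 hc hB)
      (hI'.sub ((hI (n + 1)).const_mul _))
      measurableSet_Ioi fun t ht => ?_
    have ht' : 0 < t := ht
    calc t ^ n * Real.exp (-(s * t)) * h t
        ≤ t ^ n * Real.exp (-(s * t)) * (-η + D * (t - a) ^ 2) := by
          have := hle t ht
          gcongr
      _ = _ := by ring
  rw [integral_sub hI' ((hI (n + 1)).const_mul _),
    integral_add ((hI n).const_mul _) ((hI (n + 2)).const_mul _), integral_const_mul,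
    integral_const_mul, integral_const_mul, integral_pow_mul_exp_neg_mul _ hs0,
    integral_pow_mul_exp_neg_mul _ hs0, integral_pow_mul_exp_neg_mul _ hs0] at h1
  have h2 := (hpos n s hs0).trans h1
  -- Under the normalised kernel the mean of `(t - a) ^ 2` is `a ^ 2 * (n + 2) / n ^ 2`. As `n + 2 ≤
  -- 3 * n`, the choice of `n` puts `D` times this below `η`.
  have h3 : (D * a ^ 2 - η) * (n.factorial / s ^ (n + 1)) +
      D * ((n + 2).factorial / s ^ (n + 2 + 1)) -
      2 * a * D * ((n + 1).factorial / s ^ (n + 1 + 1)) =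
      n.factorial / s ^ (n + 1) * (D * a ^ 2 * (n + 2) / n ^ 2 - η) := by
    have hsa : s * a = n := by rw [hs]; field_simp
    have e1 : ((n + 1).factorial : ℝ) = (n + 1) * n.factorial := by
      rw [Nat.factorial_succ]; push_cast; ring
    have e2 : ((n + 2).factorial : ℝ) = (n + 2) * ((n + 1) * n.factorial) := by
      rw [Nat.factorial_succ, Nat.factorial_succ]; push_cast; ring
    rw [e1, e2, pow_succ s (n + 2), pow_succ s (n + 1), ← hsa]
    field_simp
    ring
  rw [h3] at h2
  have h4 : 0 ≤ D * a ^ 2 * (n + 2) / n ^ 2 - η :=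
    nonneg_of_mul_nonneg_right h2 (by positivity)
  have h5 : η * n ^ 2 ≤ D * a ^ 2 * (n + 2) := by
    rw [← le_div_iff₀ (by positivity)]
    linarith
  have h6 : D * a ^ 2 * (n + 2) ≤ 3 * D * a ^ 2 * n := by
    have : 0 ≤ D * a ^ 2 := by positivity
    nlinarith
  nlinarith

lemma wrightDensity_nonneg {α : ℝ} (hα0 : 0 < α) (hα1 : α < 1) {θ : ℝ} (hθ : 0 < θ) {t : ℝ}
    (ht : 0 < t) : 0 ≤ wrightDensity α θ t := by
  obtain ⟨B, hB⟩ := exists_abs_wrightDensity_le hα0 hα1 hθ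
  have hc : ContinuousOn (wrightDensity α θ) (Ioi 0) :=
    (continuousOn_wrightDensity hα0 hα1 hθ).mono Ioi_subset_Ici_self
  have hB' : ∀ t, 0 < t → |wrightDensity α θ t| ≤ B := fun t ht => hB t ht.le
  refine nonneg_of_forall_integral_pow_mul_exp_nonneg hc hB' (fun n s hs => ?_) ht
  have hA : AlternatingDerivs n (fun s => 1 * s ^ (α - 1) * Real.exp (-(θ * s ^ α))) :=
    (AlternatingDerivs.const_mul_rpow n zero_le_one (by linarith)).mul
      (AlternatingDerivs.exp_neg_mul_rpow n hα0 hα1 hθ.le)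
  have := hA.nonneg_of_hasDerivAt (k := 0)
    (F := fun n s => ∫ t in Ioi (0 : ℝ), t ^ n * Real.exp (-(s * t)) * wrightDensity α θ t)
    (fun k s hs => hasDerivAt_integral_pow_mul_exp_neg_mul k hs hc hB') (fun s hs => ?_) s hs
  · simpa only [zero_add] using this
  · simp only [pow_zero, one_mul]
    exact (laplace_wrightDensity hα0 hα1 hθ.le hs).symm

lemma mWright_nonneg {α : ℝ} (hα0 : 0 < α) (hα1 : α < 1) {θ : ℝ} (hθ : 0 ≤ θ) :
    0 ≤ mWright α θ := by
  rcases hθ.eq_or_lt with rfl | hθ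
  · rw [mWright_zero]
    exact inv_nonneg.2 (Real.Gamma_pos_of_pos (sub_pos.2 hα1)).le
  · rw [← wrightDensity_one hα0 hα1]
    exact wrightDensity_nonneg hα0 hα1 hθ one_pos

/-! ### Moments of the M-Wright function -/

lemma measurable_mWright {α : ℝ} (hα0 : 0 < α) (hα1 : α < 1) : Measurable (mWright α) := by
  refine measurable_of_tendsto_metrizable (f := fun n θ => ∑ k ∈ Finset.range n,
    (-θ) ^ k / ((k.factorial : ℝ) * Real.Gamma (1 - α * ((k : ℝ) + 1)))) (fun n => by fun_prop) ?_
  exact tendsto_pi_nhds.2 fun θ => (summable_mWright hα0 hα1 θ).hasSum.tendsto_sum_nat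

lemma lintegral_comp_mul_left_Ioi {c : ℝ} (hc : 0 < c) (g : ℝ → ENNReal) :
    ∫⁻ x in Ioi (0 : ℝ), g x = ENNReal.ofReal c * ∫⁻ x in Ioi (0 : ℝ), g (c * x) := by
  have h := lintegral_image_eq_lintegral_abs_deriv_mul (s := Ioi (0 : ℝ)) (f := fun x => c * x)
    (f' := fun _ => c) measurableSet_Ioi
    (fun x _ => by simpa using ((hasDerivAt_id x).const_mul c).hasDerivWithinAt)
    (mul_right_injective₀ hc.ne').injOn g
  rw [image_mul_left_Ioi hc, mul_zero] at h
  rw [h, abs_of_pos hc, lintegral_const_mul' _ _ ENNReal.ofReal_ne_top]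

lemma lintegral_pow_mul_exp_neg (n : ℕ) :
    ∫⁻ θ in Ioi (0 : ℝ), ENNReal.ofReal (θ ^ n * Real.exp (-θ)) =
      ENNReal.ofReal n.factorial := by
  have h1 := integrableOn_pow_mul_exp_neg_mul n one_pos
  have h2 := integral_pow_mul_exp_neg_mul n one_pos
  simp only [one_mul, one_pow, div_one] at h1 h2
  rw [← h2, ofReal_integral_eq_lintegral_ofReal h1]
  filter_upwards [ae_restrict_mem measurableSet_Ioi] with t ht
  have ht' : 0 < t := ht
  positivity

lemma lintegral_exp_neg_mul_wrightDensity {α : ℝ} (hα0 : 0 < α) (hα1 : α < 1) {θ : ℝ}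
    (hθ : 0 < θ) :
    ∫⁻ t in Ioi (0 : ℝ), ENNReal.ofReal (Real.exp (-t) * wrightDensity α θ t) =
      ENNReal.ofReal (Real.exp (-θ)) := by
  obtain ⟨B, hB⟩ := exists_abs_wrightDensity_le hα0 hα1 hθ
  have hint := integrableOn_pow_mul_exp_neg_mul_mul 0 one_pos
    ((continuousOn_wrightDensity hα0 hα1 hθ).mono Ioi_subset_Ici_self) fun t ht => hB t ht.le
  simp only [pow_zero, one_mul] at hint
  rw [← laplace_wrightDensity_one hα0 hα1 hθ.le, ofReal_integral_eq_lintegral_ofReal hint]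
  filter_upwards [ae_restrict_mem measurableSet_Ioi] with t ht
  exact mul_nonneg (Real.exp_pos _).le (wrightDensity_nonneg hα0 hα1 hθ ht)

lemma lintegral_pow_mul_wrightDensity {α : ℝ} (hα0 : 0 < α) (hα1 : α < 1) (n : ℕ) {t : ℝ}
    (ht : 0 < t) :
    ∫⁻ θ in Ioi (0 : ℝ), ENNReal.ofReal (θ ^ n * wrightDensity α θ t) =
      ENNReal.ofReal (t ^ (α * n)) *
        ∫⁻ θ in Ioi (0 : ℝ), ENNReal.ofReal (θ ^ n * mWright α θ) := by
  have hc : 0 < t ^ α := Real.rpow_pos_of_pos ht _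
  rw [lintegral_comp_mul_left_Ioi hc, ← lintegral_const_mul' _ _ ENNReal.ofReal_ne_top,
    ← lintegral_const_mul' _ _ ENNReal.ofReal_ne_top]
  refine setLIntegral_congr_fun measurableSet_Ioi fun θ _ => ?_
  rw [← ENNReal.ofReal_mul hc.le, ← ENNReal.ofReal_mul (Real.rpow_nonneg ht.le _),
    wrightDensity_eq hα0 hα1 _ ht, Real.rpow_neg ht.le, Real.rpow_mul ht.le, Real.rpow_natCast,
    mul_pow, mul_comm (t ^ α) θ, mul_assoc θ, mul_inv_cancel₀ hc.ne', mul_one]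
  congr 1
  field_simp

/-- Tonelli for `e^{-t} θⁿ t^{-α} M_α(θ t^{-α})`. Working with `lintegral` avoids assuming that the
moment is finite; its finiteness is part of the conclusion. -/
lemma lintegral_pow_mul_mWright {α : ℝ} (hα0 : 0 < α) (hα1 : α < 1) (n : ℕ) :
    ∫⁻ θ in Ioi (0 : ℝ), ENNReal.ofReal (θ ^ n * mWright α θ) =
      ENNReal.ofReal (n.factorial / Real.Gamma (α * n + 1)) := by
  have hG : 0 < Real.Gamma (α * n + 1) := Real.Gamma_pos_of_pos (by positivity)
  set A := ∫⁻ θ in Ioi (0 : ℝ), ENNReal.ofReal (θ ^ n * mWright α θ) with hA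
  have hM := measurable_mWright hα0 hα1
  have hswap : ∫⁻ t in Ioi (0 : ℝ), ∫⁻ θ in Ioi (0 : ℝ),
        ENNReal.ofReal (Real.exp (-t) * θ ^ n * (t ^ (-α) * mWright α (θ * t ^ (-α)))) =
      ∫⁻ θ in Ioi (0 : ℝ), ∫⁻ t in Ioi (0 : ℝ),
        ENNReal.ofReal (Real.exp (-t) * θ ^ n * (t ^ (-α) * mWright α (θ * t ^ (-α)))) :=
    lintegral_lintegral_swap (Measurable.aemeasurable (by fun_prop))
  have hleft : ∫⁻ t in Ioi (0 : ℝ), ∫⁻ θ in Ioi (0 : ℝ),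
        ENNReal.ofReal (Real.exp (-t) * θ ^ n * (t ^ (-α) * mWright α (θ * t ^ (-α)))) =
      ENNReal.ofReal (Real.Gamma (α * n + 1)) * A := by
    have e : ∀ t ∈ Ioi (0 : ℝ), ∫⁻ θ in Ioi (0 : ℝ),
        ENNReal.ofReal (Real.exp (-t) * θ ^ n * (t ^ (-α) * mWright α (θ * t ^ (-α)))) =
        ENNReal.ofReal (Real.exp (-t) * t ^ (α * n + 1 - 1)) * A := by
      intro t ht
      have ht' : 0 < t := ht
      simp_rw [← wrightDensity_eq hα0 hα1 _ ht', mul_assoc,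
        ENNReal.ofReal_mul (Real.exp_pos (-t)).le]
      rw [lintegral_const_mul' _ _ ENNReal.ofReal_ne_top,
        lintegral_pow_mul_wrightDensity hα0 hα1 n ht', add_sub_cancel_right, mul_assoc]
    rw [setLIntegral_congr_fun measurableSet_Ioi e, lintegral_mul_const _ (by fun_prop),
      Real.Gamma_eq_integral (by positivity), ofReal_integral_eq_lintegral_ofReal
        (Real.GammaIntegral_convergent (by positivity))]
    filter_upwards [ae_restrict_mem measurableSet_Ioi] with t ht
    have ht' : 0 < t := ht
    positivity
  have hright : ∫⁻ θ in Ioi (0 : ℝ), ∫⁻ t in Ioi (0 : ℝ),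
        ENNReal.ofReal (Real.exp (-t) * θ ^ n * (t ^ (-α) * mWright α (θ * t ^ (-α)))) =
      ENNReal.ofReal n.factorial := by
    rw [← lintegral_pow_mul_exp_neg]
    refine setLIntegral_congr_fun measurableSet_Ioi fun θ hθ => ?_
    have hθ' : 0 < θ := hθ
    rw [ENNReal.ofReal_mul (by positivity), ← lintegral_exp_neg_mul_wrightDensity hα0 hα1 hθ',
      ← lintegral_const_mul' _ _ ENNReal.ofReal_ne_top]
    refine setLIntegral_congr_fun measurableSet_Ioi fun t ht => ?_
    rw [← wrightDensity_eq hα0 hα1 θ ht, ← ENNReal.ofReal_mul (by positivity)]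
    congr 1
    ring
  rw [hleft, hright] at hswap
  rw [ENNReal.ofReal_div_of_pos hG, ENNReal.eq_div_iff (by simpa using hG) ENNReal.ofReal_ne_top,
    hswap]

lemma pow_mul_mWright_nonneg {α : ℝ} (hα0 : 0 < α) (hα1 : α < 1) (n : ℕ) :
    0 ≤ᵐ[volume.restrict (Ioi 0)] fun θ : ℝ => θ ^ n * mWright α θ := by
  filter_upwards [ae_restrict_mem measurableSet_Ioi] with θ hθ
  have hθ' : 0 < θ := hθ
  exact mul_nonneg (by positivity) (mWright_nonneg hα0 hα1 hθ'.le)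

lemma integrableOn_pow_mul_mWright {α : ℝ} (hα0 : 0 < α) (hα1 : α < 1) (n : ℕ) :
    IntegrableOn (fun θ : ℝ => θ ^ n * mWright α θ) (Ioi 0) := by
  have hM := measurable_mWright hα0 hα1
  refine ⟨Measurable.aestronglyMeasurable (by fun_prop), ?_⟩
  rw [hasFiniteIntegral_iff_ofReal (pow_mul_mWright_nonneg hα0 hα1 n),
    lintegral_pow_mul_mWright hα0 hα1]
  exact ENNReal.ofReal_lt_top

lemma integral_pow_mul_mWright {α : ℝ} (hα0 : 0 < α) (hα1 : α < 1) (n : ℕ) :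
    ∫ θ in Ioi (0 : ℝ), θ ^ n * mWright α θ = n.factorial / Real.Gamma (α * n + 1) := by
  have hG : 0 < Real.Gamma (α * n + 1) := Real.Gamma_pos_of_pos (by positivity)
  rw [integral_eq_lintegral_of_nonneg_ae (pow_mul_mWright_nonneg hα0 hα1 n)
    (integrableOn_pow_mul_mWright hα0 hα1 n).aestronglyMeasurable,
    lintegral_pow_mul_mWright hα0 hα1, ENNReal.toReal_ofReal (by positivity)]

lemma integrableOn_mWright {α : ℝ} (hα0 : 0 < α) (hα1 : α < 1) :
    IntegrableOn (mWright α) (Ioi 0) := by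
  simpa using integrableOn_pow_mul_mWright hα0 hα1 0

lemma integral_mWright {α : ℝ} (hα0 : 0 < α) (hα1 : α < 1) :
    ∫ θ in Ioi (0 : ℝ), mWright α θ = 1 := by
  simpa using integral_pow_mul_mWright hα0 hα1 0

/-! ### The subordination identity -/

/-- By monotone convergence the integral is the sum of `xᵏ / k!` times the moments, which is the
convergent series of `E_α(x)`. It provides the dominating function for the Bochner integral. -/
lemma lintegral_mWright_mul_exp_lt_top {α : ℝ} (hα0 : 0 < α) (hα1 : α < 1) {x : ℝ}
    (hx : 0 ≤ x) :
    ∫⁻ θ in Ioi (0 : ℝ), ENNReal.ofReal (mWright α θ * Real.exp (θ * x)) < ⊤ := by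
  have hM := measurable_mWright hα0 hα1
  have e : ∀ θ ∈ Ioi (0 : ℝ), ENNReal.ofReal (mWright α θ * Real.exp (θ * x)) =
      ∑' k : ℕ, ENNReal.ofReal (x ^ k / k.factorial) *
        ENNReal.ofReal (θ ^ k * mWright α θ) := by
    intro θ hθ
    have hθ' : 0 < θ := hθ
    have hM0 := mWright_nonneg hα0 hα1 hθ'.le
    have h : HasSum (fun k : ℕ => (θ * x) ^ k / k.factorial) (Real.exp (θ * x)) := by
      rw [Real.exp_eq_exp_ℝ]
      exact NormedSpace.expSeries_div_hasSum_exp _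
    have h' := h.mul_left (mWright α θ)
    rw [← h'.tsum_eq, ENNReal.ofReal_tsum_of_nonneg (fun k => by positivity) h'.summable]
    refine tsum_congr fun k => ?_
    rw [← ENNReal.ofReal_mul (by positivity), mul_pow]
    congr 1
    ring
  rw [setLIntegral_congr_fun measurableSet_Ioi e, lintegral_tsum fun k => by fun_prop]
  have h2 : ∀ k : ℕ, ∫⁻ θ in Ioi (0 : ℝ), ENNReal.ofReal (x ^ k / k.factorial) *
      ENNReal.ofReal (θ ^ k * mWright α θ) =
      ENNReal.ofReal ((Real.Gamma (α * k + 1))⁻¹ * x ^ k) := by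
    intro k
    rw [lintegral_const_mul' _ _ ENNReal.ofReal_ne_top, lintegral_pow_mul_mWright hα0 hα1,
      ← ENNReal.ofReal_mul (by positivity)]
    congr 1
    have : (k.factorial : ℝ) ≠ 0 := by positivity
    field_simp
  simp_rw [h2]
  exact (summable_inv_Gamma_mul_pow hα0 hα1 x).tsum_ofReal_lt_top

lemma norm_exp_le_exp_norm {A : Type*} [NormedRing A] [NormOneClass A] [NormedAlgebra ℝ A] (a : A) :
    ‖NormedSpace.exp a‖ ≤ Real.exp ‖a‖ := by
  rw [NormedSpace.exp_eq_tsum ℝ]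
  have h : HasSum (fun k : ℕ => ‖a‖ ^ k / k.factorial) (Real.exp ‖a‖) := by
    rw [Real.exp_eq_exp_ℝ]
    exact NormedSpace.expSeries_div_hasSum_exp _
  refine tsum_of_norm_bounded h fun k => ?_
  rw [norm_smul, norm_inv, Real.norm_natCast, div_eq_inv_mul]
  gcongr
  exact norm_pow_le a k

lemma continuous_exp_smul {A : Type*} [NormedRing A] [NormedAlgebra ℝ A] [CompleteSpace A]
    (a : A) : Continuous fun θ : ℝ => NormedSpace.exp (θ • a) := by
  let : NormedAlgebra ℚ A := NormedAlgebra.restrictScalars ℚ ℝ A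
  exact NormedSpace.exp_continuous.comp (continuous_id.smul continuous_const)

lemma integrableOn_mWright_smul_exp {α : ℝ} (hα0 : 0 < α) (hα1 : α < 1) {A : Type*}
    [NormedRing A] [NormOneClass A] [NormedAlgebra ℝ A] [CompleteSpace A] (a : A) :
    IntegrableOn (fun θ : ℝ => mWright α θ • NormedSpace.exp (θ • a)) (Ioi 0) := by
  have hM := measurable_mWright hα0 hα1
  have hdom : IntegrableOn (fun θ : ℝ => mWright α θ * Real.exp (θ * ‖a‖)) (Ioi 0) := by
    refine ⟨Measurable.aestronglyMeasurable (by fun_prop), ?_⟩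
    rw [hasFiniteIntegral_iff_ofReal]
    · exact lintegral_mWright_mul_exp_lt_top hα0 hα1 (norm_nonneg a)
    · filter_upwards [ae_restrict_mem measurableSet_Ioi] with θ hθ
      have hθ' : 0 < θ := hθ
      exact mul_nonneg (mWright_nonneg hα0 hα1 hθ'.le) (Real.exp_pos _).le
  refine hdom.mono' (hM.aestronglyMeasurable.smul (continuous_exp_smul a).aestronglyMeasurable) ?_
  filter_upwards [ae_restrict_mem measurableSet_Ioi] with θ hθ
  have hθ' : 0 < θ := hθ
  have hM0 := mWright_nonneg hα0 hα1 hθ'.le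
  rw [norm_smul, Real.norm_of_nonneg hM0]
  gcongr
  refine (norm_exp_le_exp_norm _).trans_eq ?_
  rw [norm_smul, Real.norm_of_nonneg hθ'.le]

/-- The moment `k! / Γ(αk + 1)` cancels the `k!` of the exponential series. The exchange of sum and
integral is absolute because `M_α ≥ 0` turns the norms into the same moments. -/
theorem mittagLeffler_eq_integral {α : ℝ} (hα0 : 0 < α) (hα1 : α < 1) {A : Type*}
    [NormedRing A] [NormOneClass A] [NormedAlgebra ℝ A] [CompleteSpace A] (a : A) :
    mittagLeffler α a = ∫ θ in Ioi (0 : ℝ), mWright α θ • NormedSpace.exp (θ • a) := by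
  let F : ℕ → ℝ → A := fun k θ => ((k.factorial : ℝ)⁻¹ * (θ ^ k * mWright α θ)) • a ^ k
  have hF : ∀ k, IntegrableOn (F k) (Ioi 0) := fun k =>
    ((integrableOn_pow_mul_mWright hα0 hα1 k).const_mul _).smul_const _
  have hval : ∀ k : ℕ, (k.factorial : ℝ)⁻¹ * (k.factorial / Real.Gamma (α * k + 1)) =
      (Real.Gamma (α * k + 1))⁻¹ := by
    intro k
    have : (k.factorial : ℝ) ≠ 0 := by positivity
    field_simp
  have hFint : ∀ k, ∫ θ in Ioi (0 : ℝ), F k θ = (Real.Gamma (α * k + 1))⁻¹ • a ^ k := by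
    intro k
    simp only [F]
    rw [integral_smul_const, integral_const_mul, integral_pow_mul_mWright hα0 hα1, hval]
  have hFnorm : ∀ k, ∫ θ in Ioi (0 : ℝ), ‖F k θ‖ = (Real.Gamma (α * k + 1))⁻¹ * ‖a ^ k‖ := by
    intro k
    rw [← hval, ← integral_pow_mul_mWright hα0 hα1, ← integral_const_mul, ← integral_mul_const]
    refine setIntegral_congr_fun measurableSet_Ioi fun θ hθ => ?_
    have hθ' : 0 < θ := hθ
    have hM0 := mWright_nonneg hα0 hα1 hθ'.le
    simp only [F]
    rw [norm_smul, Real.norm_of_nonneg (by positivity)]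
  have hsum : Summable fun k => ∫ θ in Ioi (0 : ℝ), ‖F k θ‖ := by
    simp_rw [hFnorm]
    refine (summable_inv_Gamma_mul_pow hα0 hα1 ‖a‖).of_nonneg_of_le (fun k => ?_) fun k => ?_
    · have hG : 0 < Real.Gamma (α * k + 1) := Real.Gamma_pos_of_pos (by positivity)
      positivity
    · have hG : 0 < Real.Gamma (α * k + 1) := Real.Gamma_pos_of_pos (by positivity)
      gcongr
      exact norm_pow_le a k
  have h := (hasSum_integral_of_summable_integral_norm hF hsum).tsum_eq
  simp_rw [hFint] at h
  rw [mittagLeffler, h]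
  congr 1
  funext θ
  rw [NormedSpace.exp_eq_tsum ℝ]
  simp only [F]
  rw [← tsum_const_smul'']
  refine tsum_congr fun k => ?_
  rw [smul_pow, smul_smul, smul_smul]
  congr 1
  ring

lemma integrableOn_exp_mul_mWright {α : ℝ} (hα0 : 0 < α) (hα1 : α < 1) (x : ℝ) :
    IntegrableOn (fun θ : ℝ => Real.exp (θ * x) * mWright α θ) (Ioi 0) := by
  simpa only [smul_eq_mul, ← Real.exp_eq_exp_ℝ, mul_comm (mWright α _)] using
    integrableOn_mWright_smul_exp hα0 hα1 x

lemma mittagLeffler_real_eq_integral {α : ℝ} (hα0 : 0 < α) (hα1 : α < 1) (x : ℝ) :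
    mittagLeffler α x = ∫ θ in Ioi (0 : ℝ), Real.exp (θ * x) * mWright α θ := by
  simpa only [smul_eq_mul, ← Real.exp_eq_exp_ℝ, mul_comm (mWright α _)] using
    mittagLeffler_eq_integral hα0 hα1 x

/-! ### Complete monotonicity -/

/-- The probability measure on `(0, ∞)` with density the M-Wright function. -/
noncomputable def mWrightMeasure (α : ℝ) : Measure ℝ :=
  (volume.restrict (Ioi 0)).withDensity fun θ => ENNReal.ofReal (mWright α θ)

lemma ae_mWrightMeasure_pos (α : ℝ) : ∀ᵐ θ ∂mWrightMeasure α, 0 < θ :=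
  (withDensity_absolutelyContinuous _ _).ae_le (ae_restrict_mem measurableSet_Ioi)

lemma integrable_exp_mul_mWrightMeasure {α : ℝ} (hα0 : 0 < α) (hα1 : α < 1) (x : ℝ) :
    Integrable (fun θ => Real.exp (θ * x)) (mWrightMeasure α) := by
  have hM := measurable_mWright hα0 hα1
  rw [mWrightMeasure, integrable_withDensity_iff (by fun_prop)
    (Eventually.of_forall fun _ => ENNReal.ofReal_lt_top)]
  refine (integrableOn_exp_mul_mWright hα0 hα1 x).congr ?_
  filter_upwards [ae_restrict_mem measurableSet_Ioi] with θ hθ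
  have hθ' : 0 < θ := hθ
  rw [ENNReal.toReal_ofReal (mWright_nonneg hα0 hα1 hθ'.le)]

lemma integral_exp_mul_mWrightMeasure {α : ℝ} (hα0 : 0 < α) (hα1 : α < 1) (x : ℝ) :
    ∫ θ, Real.exp (θ * x) ∂(mWrightMeasure α) = mittagLeffler α x := by
  have hM := measurable_mWright hα0 hα1
  rw [mWrightMeasure, integral_withDensity_eq_integral_toReal_smul (by fun_prop)
    (Eventually.of_forall fun _ => ENNReal.ofReal_lt_top), mittagLeffler_real_eq_integral hα0 hα1]
  refine setIntegral_congr_fun measurableSet_Ioi fun θ hθ => ?_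
  have hθ' : 0 < θ := hθ
  simp only [smul_eq_mul]
  rw [ENNReal.toReal_ofReal (mWright_nonneg hα0 hα1 hθ'.le), mul_comm]

theorem completelyMonotone_mittagLeffler {α : ℝ} (hα0 : 0 < α) (hα1 : α < 1) {x : ℝ}
    (hx : 0 ≤ x) : CompletelyMonotone fun l : ℝ => mittagLeffler α (-(x * l)) := by
  have hf : (fun l : ℝ => mittagLeffler α (-(x * l))) =
      ProbabilityTheory.mgf (fun θ => -(θ * x)) (mWrightMeasure α) := by
    funext l
    rw [ProbabilityTheory.mgf, ← integral_exp_mul_mWrightMeasure hα0 hα1]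
    congr 1
    funext θ
    ring_nf
  -- All exponential moments are finite, so the generating function is analytic on the whole line,
  -- including at the endpoint `0`.
  have hset : interior (ProbabilityTheory.integrableExpSet (fun θ => -(θ * x))
      (mWrightMeasure α)) = univ := by
    rw [interior_eq_univ, eq_univ_iff_forall]
    intro l
    have h := integrable_exp_mul_mWrightMeasure hα0 hα1 (-(x * l))
    refine h.congr (Eventually.of_forall fun θ => ?_)
    simp only
    ring_nf
  have han : AnalyticOnNhd ℝ (fun l : ℝ => mittagLeffler α (-(x * l))) univ := by
    rw [hf, ← hset]
    exact ProbabilityTheory.analyticOnNhd_mgf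
  refine ⟨han.continuousOn.mono (subset_univ _), han.contDiffOn uniqueDiffOn_univ |>.mono
    (subset_univ _), fun n l _ => ?_⟩
  -- The `n`-th derivative brings down `(-(θ * x)) ^ n`, and `(-1) ^ n` makes this factor
  -- nonnegative.
  rw [hf, ProbabilityTheory.iteratedDeriv_mgf (hset ▸ mem_univ l), ← integral_const_mul]
  refine integral_nonneg_of_ae ?_
  filter_upwards [ae_mWrightMeasure_pos α] with θ hθ
  simp only [Pi.zero_apply]
  rw [← mul_assoc, ← mul_pow, neg_one_mul, neg_neg]
  positivity

/-! ### The Mittag-Leffler function of a graph Laplacian -/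

lemma mittagLeffler_nonneg {α : ℝ} (hα0 : 0 < α) (hα1 : α < 1) (x : ℝ) :
    0 ≤ mittagLeffler α x := by
  rw [mittagLeffler_real_eq_integral hα0 hα1]
  refine setIntegral_nonneg measurableSet_Ioi fun θ hθ => ?_
  exact mul_nonneg (Real.exp_pos _).le (mWright_nonneg hα0 hα1 (le_of_lt hθ))

lemma mittagLeffler_le_one {α : ℝ} (hα0 : 0 < α) (hα1 : α < 1) {x : ℝ} (hx : x ≤ 0) :
    mittagLeffler α x ≤ 1 := by
  rw [mittagLeffler_real_eq_integral hα0 hα1, ← integral_mWright hα0 hα1]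
  refine setIntegral_mono_on (integrableOn_exp_mul_mWright hα0 hα1 x)
    (integrableOn_mWright hα0 hα1) measurableSet_Ioi fun θ hθ => ?_
  have hθ' : 0 < θ := hθ
  refine mul_le_of_le_one_left (mWright_nonneg hα0 hα1 hθ'.le) (Real.exp_le_one_iff.2 ?_)
  exact mul_nonpos_of_nonneg_of_nonpos hθ'.le hx

section Matrix

variable {V : Type*} [Fintype V] [DecidableEq V]

/-- Conjugation by the eigenvector unitary commutes with each term of the series, so the function
acts on eigenvalues. Positivity and the norm bound then reduce to `0 ≤ E_α(-y) ≤ 1` for `y ≥ 0`. -/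
lemma mittagLeffler_neg_smul_eq_conj {α : ℝ} (hα0 : 0 < α) (hα1 : α < 1) (x : ℝ)
    {L : Matrix V V ℝ} (hL : L.IsHermitian) :
    mittagLeffler α (-(x • L)) = (hL.eigenvectorUnitary : Matrix V V ℝ) *
      Matrix.diagonal (fun i => mittagLeffler α (-(x * hL.eigenvalues i))) *
        star (hL.eigenvectorUnitary : Matrix V V ℝ) := by
  have h1 : HasSum (fun (k : ℕ) (i : V) => (Real.Gamma (α * (k : ℝ) + 1))⁻¹ •
      (-(x * hL.eigenvalues i)) ^ k) (fun i => mittagLeffler α (-(x * hL.eigenvalues i))) :=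
    Pi.hasSum.2 fun i => (summable_mittagLeffler hα0 hα1 _).hasSum
  have h2 := (h1.matrix_diagonal.mul_left
    (hL.eigenvectorUnitary : Matrix V V ℝ)).mul_right
      (star (hL.eigenvectorUnitary : Matrix V V ℝ))
  rw [mittagLeffler, ← h2.tsum_eq]
  refine tsum_congr fun k => ?_
  have e : -(x • L) = Unitary.conjStarAlgAut ℝ _ hL.eigenvectorUnitary
      (Matrix.diagonal fun i => -(x * hL.eigenvalues i)) := by
    conv_lhs => rw [hL.spectral_theorem, ← map_smul, ← map_neg]
    congr 1
    ext i j
    by_cases h : i = j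
    · subst h; simp
    · simp [h]
  rw [e, ← map_pow, ← map_smul, Matrix.diagonal_pow, ← Matrix.diagonal_smul]
  rfl

lemma posSemidef_mittagLeffler_neg_smul {α : ℝ} (hα0 : 0 < α) (hα1 : α < 1) (x : ℝ)
    {L : Matrix V V ℝ} (hL : L.IsHermitian) : (mittagLeffler α (-(x • L))).PosSemidef := by
  rw [mittagLeffler_neg_smul_eq_conj hα0 hα1 x hL]
  exact (Matrix.PosSemidef.diagonal fun i =>
    mittagLeffler_nonneg hα0 hα1 _).mul_mul_conjTranspose_same _

lemma norm_mittagLeffler_neg_smul_le_one {α : ℝ} (hα0 : 0 < α) (hα1 : α < 1) {x : ℝ}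
    (hx : 0 ≤ x) {L : Matrix V V ℝ} (hL : L.PosSemidef) : ‖mittagLeffler α (-(x • L))‖ ≤ 1 := by
  rw [mittagLeffler_neg_smul_eq_conj hα0 hα1 x hL.isHermitian, ← Unitary.coe_star,
    CStarRing.norm_mul_coe_unitary, CStarRing.norm_coe_unitary_mul, Matrix.l2_opNorm_diagonal]
  refine (pi_norm_le_iff_of_nonneg zero_le_one).2 fun i => ?_
  rw [Real.norm_of_nonneg (mittagLeffler_nonneg hα0 hα1 _)]
  refine mittagLeffler_le_one hα0 hα1 ?_
  have := mul_nonneg hx (hL.eigenvalues_nonneg i)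
  linarith

/-- Only the term `k = 0` of the series acts on a vector of the kernel, with coefficient `1 / Γ(1) =
1`. -/
lemma mittagLeffler_mulVec_eq_self {α : ℝ} (hα0 : 0 < α) (hα1 : α < 1) [Nonempty V]
    {B : Matrix V V ℝ} {v : V → ℝ} (hv : Matrix.mulVec B v = 0) :
    Matrix.mulVec (mittagLeffler α B) v = v := by
  have hs := (summable_mittagLeffler hα0 hα1 B).hasSum
  have h := hs.map (Matrix.mulVec.addMonoidHomLeft v)
    (Continuous.matrix_mulVec continuous_id continuous_const)
  have h0 : HasSum (Matrix.mulVec.addMonoidHomLeft v ∘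
      fun k : ℕ => (Real.Gamma (α * (k : ℝ) + 1))⁻¹ • B ^ k) v := by
    convert hasSum_single (f := Matrix.mulVec.addMonoidHomLeft v ∘
      fun k : ℕ => (Real.Gamma (α * (k : ℝ) + 1))⁻¹ • B ^ k) 0 ?_ using 1
    · simp [Matrix.mulVec.addMonoidHomLeft]
    · intro k hk
      obtain ⟨m, rfl⟩ := Nat.exists_eq_succ_of_ne_zero hk
      simp [Matrix.mulVec.addMonoidHomLeft, pow_succ, ← Matrix.mulVec_mulVec, hv,
        Matrix.smul_mulVec]
  exact h.unique h0

lemma one_le_norm_toEuclideanCLM {P : Matrix V V ℝ} {v : V → ℝ} (hv0 : v ≠ 0)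
    (hv : Matrix.mulVec P v = v) : 1 ≤ ‖Matrix.toEuclideanCLM (n := V) (𝕜 := ℝ) P‖ := by
  have h := (Matrix.toEuclideanCLM (n := V) (𝕜 := ℝ) P).le_opNorm (WithLp.toLp 2 v)
  rw [Matrix.toEuclideanCLM_toLp, hv] at h
  have hpos : 0 < ‖WithLp.toLp 2 v‖ := norm_pos_iff.2 (by simpa using hv0)
  exact le_of_mul_le_mul_right (by simpa using h) hpos

end Matrix

theorem mainTheorem4 (α : ℝ) (hα0 : 0 < α) (hα1 : α < 1) (t : ℝ) (ht : 0 ≤ t)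
    {V : Type*} [Fintype V] [DecidableEq V] [Nonempty V]
    (G : SimpleGraph V) [DecidableRel G.Adj] :
    -- the defining series converge
    ((∀ x : ℝ, Summable fun k : ℕ => (Real.Gamma (α * (k : ℝ) + 1))⁻¹ • x ^ k) ∧
      (∀ B : Matrix V V ℝ, Summable fun k : ℕ => (Real.Gamma (α * (k : ℝ) + 1))⁻¹ • B ^ k) ∧
      (∀ θ : ℝ, Summable fun k : ℕ =>
        (-θ) ^ k / ((k.factorial : ℝ) * Real.Gamma (1 - α * ((k : ℝ) + 1))))) ∧
    -- complete monotonicity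
    CompletelyMonotone (fun l : ℝ => mittagLeffler α (-(t ^ α * l))) ∧
    -- the M-Wright function is a probability density on `(0, ∞)`
    ((∀ θ : ℝ, 0 ≤ θ → 0 ≤ mWright α θ) ∧
      MeasureTheory.IntegrableOn (mWright α) (Set.Ioi 0) ∧
      ∫ θ in Set.Ioi (0 : ℝ), mWright α θ = 1) ∧
    -- scalar subordination identity
    (∀ l : ℝ, 0 ≤ l →
      MeasureTheory.IntegrableOn (fun θ : ℝ => Real.exp (-(θ * t ^ α * l)) * mWright α θ)
        (Set.Ioi 0) ∧
      mittagLeffler α (-(t ^ α * l)) =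
        ∫ θ in Set.Ioi (0 : ℝ), Real.exp (-(θ * t ^ α * l)) * mWright α θ) ∧
    -- operator subordination identity (Bochner integral of heat semigroups)
    (MeasureTheory.IntegrableOn
        (fun θ : ℝ => mWright α θ • NormedSpace.exp (-((θ * t ^ α) • G.lapMatrix ℝ)))
        (Set.Ioi 0) ∧
      mittagLeffler α (-(t ^ α • G.lapMatrix ℝ)) =
        ∫ θ in Set.Ioi (0 : ℝ),
          mWright α θ • NormedSpace.exp (-((θ * t ^ α) • G.lapMatrix ℝ))) ∧
    -- self-adjoint, positive, of Euclidean operator norm one, and mass preserving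
    IsSelfAdjoint (mittagLeffler α (-(t ^ α • G.lapMatrix ℝ))) ∧
    (mittagLeffler α (-(t ^ α • G.lapMatrix ℝ))).PosSemidef ∧
    ‖Matrix.toEuclideanCLM (n := V) (𝕜 := ℝ) (mittagLeffler α (-(t ^ α • G.lapMatrix ℝ)))‖ = 1 ∧
    Matrix.mulVec (mittagLeffler α (-(t ^ α • G.lapMatrix ℝ))) (fun _ : V => (1 : ℝ)) =
      fun _ : V => (1 : ℝ) := by
  have hx : 0 ≤ t ^ α := Real.rpow_nonneg ht α
  have hL := G.posSemidef_lapMatrix ℝ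
  have hP := posSemidef_mittagLeffler_neg_smul hα0 hα1 (t ^ α) hL.isHermitian
  have h1 : Matrix.mulVec (mittagLeffler α (-(t ^ α • G.lapMatrix ℝ))) (fun _ : V => (1 : ℝ)) =
      fun _ : V => (1 : ℝ) := by
    refine mittagLeffler_mulVec_eq_self hα0 hα1 ?_
    rw [Matrix.neg_mulVec, Matrix.smul_mulVec, G.lapMatrix_mulVec_const_eq_zero, smul_zero,
      neg_zero]
  have hexp : ∀ θ : ℝ, NormedSpace.exp (-((θ * t ^ α) • G.lapMatrix ℝ)) =
      NormedSpace.exp (θ • -(t ^ α • G.lapMatrix ℝ)) := fun θ => by rw [smul_neg, smul_smul]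
  have hexp' : ∀ θ l : ℝ, Real.exp (-(θ * t ^ α * l)) = Real.exp (θ * -(t ^ α * l)) :=
    fun θ l => by ring_nf
  refine ⟨⟨summable_mittagLeffler hα0 hα1, summable_mittagLeffler hα0 hα1,
      summable_mWright hα0 hα1⟩, completelyMonotone_mittagLeffler hα0 hα1 hx,
    ⟨fun θ => mWright_nonneg hα0 hα1, integrableOn_mWright hα0 hα1, integral_mWright hα0 hα1⟩,
    fun l _ => ?_, ?_, hP.isHermitian, hP, le_antisymm ?_ ?_, h1⟩
  · simp_rw [hexp']
    exact ⟨integrableOn_exp_mul_mWright hα0 hα1 _, mittagLeffler_real_eq_integral hα0 hα1 _⟩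
  · simp_rw [hexp]
    exact ⟨integrableOn_mWright_smul_exp hα0 hα1 _, mittagLeffler_eq_integral hα0 hα1 _⟩
  -- The scoped operator norm on matrices unfolds to the norm of `Matrix.toEuclideanCLM`.
  · exact norm_mittagLeffler_neg_smul_le_one hα0 hα1 hx hL
  · refine one_le_norm_toEuclideanCLM (fun h => ?_) h1
    exact one_ne_zero (congrFun h (Classical.arbitrary V))
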